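/- Let $n\ge 1$, let $B\subset\mathbb R^n$ be the open unit ball, let $g$ be a smooth Riemannian metric on $\mathbb R^n$ with inverse $(g^{jk})$ and Christoffel symbols $\Gamma^i_{jk}$, and let $\omega\in C^\infty(\overline B)$ be real-valued. Let $\tilde\psi\in C^2(\overline B)$ be real-valued, without critical points in $\overline B$, and strictly $g$-convex, i.e. the matrix $\partial_j\partial_k\tilde\psi-\Gamma^i_{jk}\,\partial_i\tilde\psi$ is positive definite at every $x\in\overline B$. (Functions in $C^k(\overline B)$ are understood as $C^k$ functions in a neighbourhood of $\overline B$.) Put $$\psi=\tilde\psi+\big(\sup_B\tilde\psi-2\inf_B\tilde\psi\big),\qquad \phi(x,t)=e^{\iota\psi(x)}-\tfrac12(t-\omega(x))^2,\qquad \varphi=e^{\lambda\phi},$$ $$T=\sup_{x\in\overline B}\Big(2\big(e^{\iota\psi(x)}-\inf_{y\in\overline B}e^{\iota\psi(y)}\big)\Big)^{1/2}+\sup_{x\in\overline B}|\omega(x)|+1,$$ $$Q=B\times[-T,T],\qquad \Gamma_g=\{(x,\omega(x)):x\in\overline B\},\qquad \Gamma_{\pm T}=\overline B\times\{\pm T\}.$$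 Let $p(x,t;\xi,\tau)=g^{jk}(x)\xi_j\xi_k-\tau^2$ be the principal symbol of $\square_g=\partial_t^2-\Delta_g$, write $z=(x,t)$, $\zeta=(\xi,\tau)$, and let $\{a,b\}=\sum_j(\partial_{\zeta_j}a\,\partial_{z_j}b-\partial_{z_j}a\,\partial_{\zeta_j}b)$. A $C^2$ function $f$ on an open set $N\subset\mathbb R^{n+1}$ is called strongly pseudoconvex for $\square_g$ on $N$ if for all $z\in N$: $\nabla f(z)\ne0$; $\{p,\{p,f\}\}(z,\zeta)>0$ for every $\zeta\in\mathbb R^{n+1}\setminus\{0\}$ with $p(z,\zeta)=\{p,f\}(z,\zeta)=0$; and $\frac1{i\sigma}\big\{\overline{p(z,\zeta+i\sigma\nabla f(z))},\,p(z,\zeta+i\sigma\nabla f(z))\big\}>0$ for all $\zeta\in\mathbb R^{n+1}$ and $\sigma\in\mathbb R\setminus\{0\}$ with $p(z,\zeta+i\sigma\nabla f(z))=0$. Then there are $\iota_0,\lambda_0\in\mathbb R$ such that for all $\iota\ge\iota_0$ and $\lambda\ge\lambda_0$ the following hold. 1. $\varphi$ is strongly pseudoconvex for $\square_g$ on some open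 neighbourhood of $\overline Q$. 2. The smallest value of $\varphi$ on $\Gamma_g$ and the largest value of $\varphi$ on $\Gamma_T\cup\Gamma_{-T}$ exist and satisfy $\inf_{\Gamma_g}\varphi>\sup_{\Gamma_T\cup\Gamma_{-T}}\varphi$. 3. The function $$h(\sigma)=\sup_{x\in\overline B}\int_{-T}^{T}e^{2\sigma[\varphi(x,t)-\varphi(x,\omega(x))]}\,dt$$ is finite for every $\sigma\in\mathbb R$, and $\lim_{\sigma\to+\infty}h(\sigma)=0$. -/

import Mathlib

open Set Filter Topology

noncomputable section

/-- The space `ℝⁿ`. -/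
abbrev Space (n : ℕ) := EuclideanSpace ℝ (Fin n)

/-- Space-time `ℝⁿ × ℝ`, with points `z = (x, t)`. Covectors `(ξ, τ)` are written in the same
coordinates. -/
abbrev SpaceTime (n : ℕ) := Space n × ℝ

/-! ### Riemannian metrics on `ℝⁿ` in Cartesian coordinates -/

/-- A smooth Riemannian metric `(g_{jk}(x))` on `ℝⁿ`; `Matrix.PosDef` includes symmetry. -/
structure SmoothMetric (n : ℕ) where
  coeff : Space n → Matrix (Fin n) (Fin n) ℝ
  smooth : ∀ j k, ContDiff ℝ ((⊤ : ℕ∞) : WithTop ℕ∞) (fun x => coeff x j k)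
  posDef : ∀ x, (coeff x).PosDef

/-- The partial derivative `∂_j f` on `ℝⁿ`. -/
def partialD {n : ℕ} (j : Fin n) (f : Space n → ℝ) (x : Space n) : ℝ :=
  fderiv ℝ f x (EuclideanSpace.single j 1)

/-- `Γ^i_{jk} = ½ g^{il} (∂_j g_{lk} + ∂_k g_{lj} - ∂_l g_{jk})`. -/
def christoffel {n : ℕ} (g : SmoothMetric n) (i j k : Fin n) (x : Space n) : ℝ :=
  (1 / 2) * ∑ l, (g.coeff x)⁻¹ i l *
    (partialD j (fun y => g.coeff y l k) x + partialD k (fun y => g.coeff y l j) x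
      - partialD l (fun y => g.coeff y j k) x)

/-- The Hessian of `f` with respect to `g`: the matrix `∂_j ∂_k f - Γ^i_{jk} ∂_i f`. -/
def gHessian {n : ℕ} (g : SmoothMetric n) (f : Space n → ℝ) (x : Space n) :
    Matrix (Fin n) (Fin n) ℝ :=
  Matrix.of fun j k => partialD j (partialD k f) x - ∑ i, christoffel g i j k x * partialD i f x

/-! ### Poisson brackets and strong pseudoconvexity on space-time -/

/-- The coordinate vectors of space-time: `inl j` is the direction `x_j`, `inr ()` is `t`. -/
def coordVec {n : ℕ} : Fin n ⊕ Unit → SpaceTime n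
  | Sum.inl j => (EuclideanSpace.single j 1, 0)
  | Sum.inr _ => (0, 1)

/-- The coordinates of a space-time (co)vector. -/
def coords {n : ℕ} (ζ : SpaceTime n) : Fin n ⊕ Unit → ℝ :=
  Sum.elim (fun j => ζ.1 j) (fun _ => ζ.2)

/-- The space-time gradient of `φ`, as the list of its partial derivatives. -/
def stGrad {n : ℕ} (φ : SpaceTime n → ℝ) (z : SpaceTime n) : Fin n ⊕ Unit → ℝ :=
  fun a => fderiv ℝ φ z (coordVec a)

/-- The Poisson bracket of functions `F(z, ζ)`, `G(z, ζ)` of position and (real) covector,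
`{F, G} = Σ_a (∂F/∂ζ_a ∂G/∂z_a - ∂F/∂z_a ∂G/∂ζ_a)`; the values may be real or complex. -/
def poisson {n : ℕ} {𝕜 : Type} [RCLike 𝕜] (F G : SpaceTime n → SpaceTime n → 𝕜)
    (z ζ : SpaceTime n) : 𝕜 :=
  ∑ a : Fin n ⊕ Unit,
    (fderiv ℝ (fun η => F z η) ζ (coordVec a) * fderiv ℝ (fun w => G w ζ) z (coordVec a)
      - fderiv ℝ (fun w => F w ζ) z (coordVec a) * fderiv ℝ (fun η => G z η) ζ (coordVec a))

/-- The quadratic form `Σ m_{ab} ζ_a ζ_b` at a real or complex covector `ζ`. -/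
def quadSymbol {n : ℕ} {𝕜 : Type} [RCLike 𝕜]
    (m : Matrix (Fin n ⊕ Unit) (Fin n ⊕ Unit) ℝ) (ζ : Fin n ⊕ Unit → 𝕜) : 𝕜 :=
  ∑ a, ∑ b, (m a b : 𝕜) * ζ a * ζ b

/-- The real principal symbol `p(z, ζ) = Σ m_{ab}(z) ζ_a ζ_b` on real covectors. -/
def realSymbol {n : ℕ} (m : SpaceTime n → Matrix (Fin n ⊕ Unit) (Fin n ⊕ Unit) ℝ)
    (z ζ : SpaceTime n) : ℝ :=
  quadSymbol (m z) (coords ζ)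

/-- The conjugated symbol `(z, ζ) ↦ p(z, ζ + i σ ∇φ(z))`. -/
def conjugatedSymbol {n : ℕ} (m : SpaceTime n → Matrix (Fin n ⊕ Unit) (Fin n ⊕ Unit) ℝ)
    (φ : SpaceTime n → ℝ) (σ : ℝ) (z ζ : SpaceTime n) : ℂ :=
  quadSymbol (m z) (fun a => (coords ζ a : ℂ) + Complex.I * (σ : ℂ) * (stGrad φ z a : ℂ))

/-- Strong pseudoconvexity of the function `φ` on the (open) set `N` with respect to a second order
operator with real principal symbol `p(z, ζ) = Σ m_{ab}(z) ζ_a ζ_b`: `φ` is `C²` without critical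
points, `{p, {p, φ}} > 0` at real `ζ ≠ 0` with `p = {p, φ} = 0`, and, with `σ ≠ 0`,
`(1 / iσ) { conj p(z, ζ + iσ∇φ), p(z, ζ + iσ∇φ) } > 0` wherever `p(z, ζ + iσ∇φ) = 0`.
(The bracket of the conjugate of a function with the function is purely imaginary, so that the
last quantity is real.) -/
structure StronglyPseudoconvexOn {n : ℕ}
    (m : SpaceTime n → Matrix (Fin n ⊕ Unit) (Fin n ⊕ Unit) ℝ)
    (φ : SpaceTime n → ℝ) (N : Set (SpaceTime n)) : Prop where
  contDiffOn : ContDiffOn ℝ 2 φ N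
  grad_ne_zero : ∀ z ∈ N, fderiv ℝ φ z ≠ 0
  real_pos : ∀ z ∈ N, ∀ ζ : SpaceTime n, ζ ≠ 0 →
    realSymbol m z ζ = 0 →
    poisson (realSymbol m) (fun w _ => φ w) z ζ = 0 →
    0 < poisson (realSymbol m) (poisson (realSymbol m) (fun w _ => φ w)) z ζ
  complex_pos : ∀ z ∈ N, ∀ ζ : SpaceTime n, ∀ σ : ℝ, σ ≠ 0 →
    conjugatedSymbol m φ σ z ζ = 0 →
    0 < (poisson (fun w η => (starRingEnd ℂ) (conjugatedSymbol m φ σ w η))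
          (conjugatedSymbol m φ σ) z ζ / (Complex.I * (σ : ℂ))).re

/-- The coefficients of the principal symbol `g^{jk}(x) ξ_j ξ_k - τ²` of `□_g = ∂_t² - Δ_g`. -/
def boxSymbol {n : ℕ} (g : SmoothMetric n) (z : SpaceTime n) :
    Matrix (Fin n ⊕ Unit) (Fin n ⊕ Unit) ℝ :=
  Matrix.fromBlocks (g.coeff z.1)⁻¹ 0 0 (-1)

/-! ### The unit ball, the cylinder and the weight -/

/-- The open unit ball `B`. -/
def unitBall (n : ℕ) : Set (Space n) := Metric.ball 0 1

/-- The closed unit ball. -/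
def closedUnitBall (n : ℕ) : Set (Space n) := Metric.closedBall 0 1

/-- `f ∈ C^k(B̄)`: `f` is of class `C^k` in an open neighbourhood of `B̄`. -/
def ContDiffNearBall {n : ℕ} (k : WithTop ℕ∞) (f : Space n → ℝ) : Prop :=
  ∃ U : Set (Space n), IsOpen U ∧ closedUnitBall n ⊆ U ∧ ContDiffOn ℝ k f U

/-- `ψ = ψ̃ + (sup_B ψ̃ - 2 inf_B ψ̃)`. -/
def shifted {n : ℕ} (ψt : Space n → ℝ) (x : Space n) : ℝ :=
  ψt x + (sSup (ψt '' unitBall n) - 2 * sInf (ψt '' unitBall n))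

/-- `φ(x, t) = e^{ι ψ(x)} - (t - ω(x))² / 2`. -/
def phase {n : ℕ} (ι : ℝ) (ψ ω : Space n → ℝ) (z : SpaceTime n) : ℝ :=
  Real.exp (ι * ψ z.1) - (z.2 - ω z.1) ^ 2 / 2

/-- The weight `e^{λ φ(x, t)}`. -/
def weight {n : ℕ} (ι lam : ℝ) (ψ ω : Space n → ℝ) (z : SpaceTime n) : ℝ :=
  Real.exp (lam * phase ι ψ ω z)

/-- `T = sup_{x ∈ B̄} (2 (e^{ι ψ(x)} - inf_{y ∈ B̄} e^{ι ψ(y)}))^{1/2} + sup_{x ∈ B̄} |ω(x)| + 1`. -/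
def halfHeight {n : ℕ} (ι : ℝ) (ψ ω : Space n → ℝ) : ℝ :=
  sSup ((fun x => Real.sqrt (2 * (Real.exp (ι * ψ x)
      - sInf ((fun y => Real.exp (ι * ψ y)) '' closedUnitBall n)))) '' closedUnitBall n)
    + sSup ((fun x => |ω x|) '' closedUnitBall n) + 1

/-- The cylinder `Q = B × [-T, T]`. -/
def cylinder (n : ℕ) (T : ℝ) : Set (SpaceTime n) := unitBall n ×ˢ Icc (-T) T

/-- The hypersurface `Γ_g = {(x, t) ∈ B̄ × ℝ : t = ω(x)}`. -/
def graphSurface {n : ℕ} (ω : Space n → ℝ) : Set (SpaceTime n) :=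
  {z | z.1 ∈ closedUnitBall n ∧ z.2 = ω z.1}

/-- The (closed) horizontal slice `Γ_τ = {(x, t) ∈ B̄ × ℝ : t = τ}`. -/
def slice (n : ℕ) (τ : ℝ) : Set (SpaceTime n) := {z | z.1 ∈ closedUnitBall n ∧ z.2 = τ}

/-- The set of the values `∫_{-T}^{T} e^{2σ[φ(x, t) - φ(x, ω(x))]} dt` for `x ∈ B̄`. -/
def weightIntegrals {n : ℕ} (φ : SpaceTime n → ℝ) (ω : Space n → ℝ) (T σ : ℝ) : Set ℝ :=
  (fun x => ∫ t in (-T)..T, Real.exp (2 * σ * (φ (x, t) - φ (x, ω x)))) '' closedUnitBall n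

end

/-! Let D(ζ) be the quadratic form in ζ given by `doubleBracket`, i.e. the value of {p,{p,φ}}, and
put N = ∇φ. The conjugated bracket divided by iσ equals 2(D(ζ) + σ² D(N))
(`poisson_conjugatedSymbol`), so both bracket conditions reduce to positivity of D at suitable real
covectors. For the wave symbol, D(ζ) is four times the Lorentzian Hessian of φ at the velocity (X,
-τ), X = g⁻¹ξ (`doubleBracket_boxSymbol`). Passing from a phase to its exponential multiplies D by a
positive factor after adding a square (`doubleBracket_exp`), so it suffices to treat the phase, and
any λ > 0 will do.

With e = e^{ιψ(x)} and u = t - ω(x), a quarter of D for the phase is ι e Hess ψ(X,X) + u Hess ω(X,X)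
+ ι² e (dψ·X)² - (dω·X + τ)². When ζ is not timelike, the last square is O(|X|²); when moreover |u|
≤ M e with M independent of ι, the second term is O(e|X|²). Convexity of ψ then wins for large ι
(`UniformBounds.hess_phase_pos`). The same bound on u lets ι e ∇ψ dominate the gradient of the
phase, so N is spacelike (`UniformBounds.sq_lt_bilin_grad_phase`). If the conjugated symbol
vanishes, its real part gives p(ζ) = σ² p(N) > 0: both ζ and N are spacelike and D is positive at
each.

The delicate point is that M must not depend on ι although T grows with ι. The shift in ψ provides
this: 0 ≤ ψ(x) ≤ 2ψ(y) on the closed ball, so √(2e^{ιψ(x)}) ≤ 2e^{ιψ(y)} and T is controlled by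
e^{ιψ} at every single point (`halfHeight_le`).

The height T is such that for |t| = T the phase lies below the minimum of e^{ιψ} (`phase_slice_lt`).
For the integrals, φ(x,t) - φ(x,ω(x)) = e^{λe}(e^{-λu²/2} - 1) ≤ e^{-λu²/2} - 1, which is negative
off u = 0 and free of x once u is the variable; dominated convergence concludes. -/

noncomputable section

/-! ### Quadratic symbols and their derivatives -/

/-- The coordinate functional `ζ ↦ ζ_a` on space-time. -/
def coordProj {n : ℕ} (a : Fin n ⊕ Unit) : SpaceTime n →L[ℝ] ℝ :=
  Sum.elim (fun j => (EuclideanSpace.proj j).comp (ContinuousLinearMap.fst ℝ (Space n) ℝ))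
    (fun _ => ContinuousLinearMap.snd ℝ (Space n) ℝ) a

theorem coords_eq_coordProj {n : ℕ} (ζ : SpaceTime n) (a : Fin n ⊕ Unit) :
    coords ζ a = coordProj a ζ := by
  cases a <;> simp [coords, coordProj]

theorem coordProj_coordVec {n : ℕ} (a b : Fin n ⊕ Unit) :
    coordProj b (coordVec a) = if a = b then (1 : ℝ) else 0 := by
  rcases a with j | _ <;> rcases b with k | _ <;>
    simp [coordProj, coordVec, eq_comm]

theorem hasFDerivAt_coords {n : ℕ} (ζ : SpaceTime n) (a : Fin n ⊕ Unit) :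
    HasFDerivAt (fun η : SpaceTime n => coords η a) (coordProj a) ζ := by
  simp only [coords_eq_coordProj]
  exact (coordProj a).hasFDerivAt

/-- The bilinear form `Σ m_{ab} v_a w_b`. -/
def bilinSymbol {ι : Type*} [Fintype ι] (m : Matrix ι ι ℝ) (v w : ι → ℝ) : ℝ :=
  ∑ a, ∑ b, m a b * v a * w b

theorem quadSymbol_real {n : ℕ} (m : Matrix (Fin n ⊕ Unit) (Fin n ⊕ Unit) ℝ)
    (v : Fin n ⊕ Unit → ℝ) : quadSymbol m v = bilinSymbol m v v := rfl

theorem bilinSymbol_comm {ι : Type*} [Fintype ι] {m : Matrix ι ι ℝ} (hm : m.IsSymm)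
    (v w : ι → ℝ) : bilinSymbol m v w = bilinSymbol m w v := by
  unfold bilinSymbol
  rw [Finset.sum_comm]
  refine Finset.sum_congr rfl fun a _ => Finset.sum_congr rfl fun b _ => ?_
  rw [hm.apply]; ring

/-- Derivative of `Σ m_{ab} v_a w_b` along a direction, from those of the entries. -/
theorem HasFDerivAt.bilinSymbol {ι : Type*} [Fintype ι] {E : Type*} [NormedAddCommGroup E]
    [NormedSpace ℝ E] {m : E → Matrix ι ι ℝ} {v w : E → ι → ℝ} {x : E}
    {m' : ι → ι → E →L[ℝ] ℝ} {v' w' : ι → E →L[ℝ] ℝ}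
    (hm : ∀ a b, HasFDerivAt (fun y => m y a b) (m' a b) x)
    (hv : ∀ a, HasFDerivAt (fun y => v y a) (v' a) x)
    (hw : ∀ a, HasFDerivAt (fun y => w y a) (w' a) x) :
    HasFDerivAt (fun y => bilinSymbol (m y) (v y) (w y))
      (∑ a, ∑ b, ((m x a b * v x a) • w' b + w x b • (m x a b • v' a + v x a • m' a b))) x := by
  unfold _root_.bilinSymbol
  exact HasFDerivAt.fun_sum fun a _ => HasFDerivAt.fun_sum fun b _ =>
    ((hm a b).mul (hv a)).mul (hw b)

theorem sum_bilin_apply {ι : Type*} [Fintype ι] {E : Type*} [NormedAddCommGroup E]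
    [NormedSpace ℝ E] (m : Matrix ι ι ℝ) (v w : ι → ℝ) (m' : ι → ι → E →L[ℝ] ℝ)
    (v' w' : ι → E →L[ℝ] ℝ) (d : E) :
    (∑ a, ∑ b, ((m a b * v a) • w' b + w b • (m a b • v' a + v a • m' a b))) d
      = bilinSymbol (Matrix.of fun a b => m' a b d) v w + bilinSymbol m (fun a => v' a d) w
        + bilinSymbol m v (fun a => w' a d) := by
  simp only [bilinSymbol, sum_apply, add_apply,
    smul_apply, smul_eq_mul, ← Finset.sum_add_distrib, Matrix.of_apply]
  refine Finset.sum_congr rfl fun a _ => Finset.sum_congr rfl fun b _ => ?_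
  ring

theorem fderiv_bilinSymbol_apply {ι : Type*} [Fintype ι] {E : Type*} [NormedAddCommGroup E]
    [NormedSpace ℝ E] {m : E → Matrix ι ι ℝ} {v w : E → ι → ℝ} {x : E}
    (hm : ∀ a b, DifferentiableAt ℝ (fun y => m y a b) x)
    (hv : ∀ a, DifferentiableAt ℝ (fun y => v y a) x)
    (hw : ∀ a, DifferentiableAt ℝ (fun y => w y a) x) (d : E) :
    fderiv ℝ (fun y => bilinSymbol (m y) (v y) (w y)) x d
      = bilinSymbol (Matrix.of fun a b => fderiv ℝ (fun y => m y a b) x d) (v x) (w x)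
        + bilinSymbol (m x) (fun a => fderiv ℝ (fun y => v y a) x d) (w x)
        + bilinSymbol (m x) (v x) (fun a => fderiv ℝ (fun y => w y a) x d) := by
  rw [(HasFDerivAt.bilinSymbol (fun a b => (hm a b).hasFDerivAt) (fun a => (hv a).hasFDerivAt)
    (fun a => (hw a).hasFDerivAt)).fderiv, sum_bilin_apply]

theorem differentiableAt_bilinSymbol {ι : Type*} [Fintype ι] {E : Type*} [NormedAddCommGroup E]
    [NormedSpace ℝ E] {m : E → Matrix ι ι ℝ} {v w : E → ι → ℝ} {x : E}
    (hm : ∀ a b, DifferentiableAt ℝ (fun y => m y a b) x)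
    (hv : ∀ a, DifferentiableAt ℝ (fun y => v y a) x)
    (hw : ∀ a, DifferentiableAt ℝ (fun y => w y a) x) :
    DifferentiableAt ℝ (fun y => bilinSymbol (m y) (v y) (w y)) x :=
  (HasFDerivAt.bilinSymbol (fun a b => (hm a b).hasFDerivAt) (fun a => (hv a).hasFDerivAt)
    (fun a => (hw a).hasFDerivAt)).differentiableAt

theorem fderiv_coords_coordVec {n : ℕ} (ζ : SpaceTime n) (a b : Fin n ⊕ Unit) :
    fderiv ℝ (fun η : SpaceTime n => coords η b) ζ (coordVec a) = if a = b then 1 else 0 := by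
  rw [(hasFDerivAt_coords ζ b).fderiv, coordProj_coordVec]

theorem bilinSymbol_zero_left {ι : Type*} [Fintype ι] (m : Matrix ι ι ℝ) (w : ι → ℝ) :
    bilinSymbol m (fun _ => 0) w = 0 := by simp [bilinSymbol]

theorem bilinSymbol_zero_right {ι : Type*} [Fintype ι] (m : Matrix ι ι ℝ) (v : ι → ℝ) :
    bilinSymbol m v (fun _ => 0) = 0 := by simp [bilinSymbol]

theorem bilinSymbol_zero_matrix {ι : Type*} [Fintype ι] (v w : ι → ℝ) :
    bilinSymbol (Matrix.of fun _ _ => 0) v w = 0 := by simp [bilinSymbol]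

theorem bilinSymbol_single_left {ι : Type*} [Fintype ι] [DecidableEq ι] (m : Matrix ι ι ℝ)
    (a : ι) (w : ι → ℝ) :
    bilinSymbol m (fun b => if a = b then 1 else 0) w = (m.mulVec w) a := by
  simp [bilinSymbol, Matrix.mulVec, dotProduct, Finset.sum_ite_eq, ite_mul]

theorem bilinSymbol_eq_sum_mulVec {ι : Type*} [Fintype ι] (m : Matrix ι ι ℝ) (v w : ι → ℝ) :
    bilinSymbol m v w = ∑ a, (m.mulVec w) a * v a := by
  simp only [bilinSymbol, Matrix.mulVec, dotProduct, Finset.sum_mul]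
  exact Finset.sum_congr rfl fun a _ => Finset.sum_congr rfl fun b _ => by ring

/-! ### Poisson brackets for a general quadratic symbol -/

section Bracket

variable {n : ℕ} {m : SpaceTime n → Matrix (Fin n ⊕ Unit) (Fin n ⊕ Unit) ℝ}

theorem differentiableAt_bilinSymbol_coords (M : Matrix (Fin n ⊕ Unit) (Fin n ⊕ Unit) ℝ)
    (w : Fin n ⊕ Unit → ℝ) (ζ : SpaceTime n) :
    DifferentiableAt ℝ (fun η => bilinSymbol M (coords η) w) ζ :=
  differentiableAt_bilinSymbol (m := fun _ => M) (w := fun _ => w)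
    (fun _ _ => differentiableAt_const _) (fun a => (hasFDerivAt_coords ζ a).differentiableAt)
    (fun _ => differentiableAt_const _)

theorem fderiv_bilinSymbol_coords_left (M : Matrix (Fin n ⊕ Unit) (Fin n ⊕ Unit) ℝ)
    (w : Fin n ⊕ Unit → ℝ) (ζ : SpaceTime n) (a : Fin n ⊕ Unit) :
    fderiv ℝ (fun η => bilinSymbol M (coords η) w) ζ (coordVec a) = (M.mulVec w) a := by
  rw [fderiv_bilinSymbol_apply (m := fun _ => M) (w := fun _ => w)
    (fun _ _ => differentiableAt_const _)
    (fun a => (hasFDerivAt_coords ζ a).differentiableAt) (fun _ => differentiableAt_const _)]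
  simp [fderiv_coords_coordVec, bilinSymbol_zero_right, bilinSymbol_zero_matrix,
    bilinSymbol_single_left]

theorem differentiableAt_realSymbol_covector (z ζ : SpaceTime n) :
    DifferentiableAt ℝ (fun η => realSymbol m z η) ζ :=
  differentiableAt_bilinSymbol (m := fun _ => m z) (fun _ _ => differentiableAt_const _)
    (fun a => (hasFDerivAt_coords ζ a).differentiableAt)
    (fun a => (hasFDerivAt_coords ζ a).differentiableAt)

theorem fderiv_realSymbol_covector (hm : ∀ z, (m z).IsSymm) (z ζ : SpaceTime n)
    (a : Fin n ⊕ Unit) :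
    fderiv ℝ (fun η => realSymbol m z η) ζ (coordVec a) = 2 * ((m z).mulVec (coords ζ)) a := by
  simp only [realSymbol, quadSymbol_real]
  rw [fderiv_bilinSymbol_apply (m := fun _ => m z) (fun _ _ => differentiableAt_const _)
    (fun a => (hasFDerivAt_coords ζ a).differentiableAt)
    (fun a => (hasFDerivAt_coords ζ a).differentiableAt),
    bilinSymbol_comm (hm z) (coords ζ)]
  simp [fderiv_coords_coordVec, bilinSymbol_zero_matrix, bilinSymbol_single_left]
  ring

/-- The matrix of the derivatives in the direction `z_a` of the coefficients. -/
def coeffDeriv (m : SpaceTime n → Matrix (Fin n ⊕ Unit) (Fin n ⊕ Unit) ℝ) (z : SpaceTime n)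
    (a : Fin n ⊕ Unit) : Matrix (Fin n ⊕ Unit) (Fin n ⊕ Unit) ℝ :=
  Matrix.of fun b c => fderiv ℝ (fun w => m w b c) z (coordVec a)

/-- The second derivatives `∂_a ∂_b φ`. -/
def stHess (φ : SpaceTime n → ℝ) (z : SpaceTime n) (a b : Fin n ⊕ Unit) : ℝ :=
  fderiv ℝ (fun w => stGrad φ w b) z (coordVec a)

/-- The value of `{p, {p, φ}}` in terms of the derivatives of the coefficients and of `φ`. -/
def doubleBracket (M : Matrix (Fin n ⊕ Unit) (Fin n ⊕ Unit) ℝ)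
    (dM : Fin n ⊕ Unit → Matrix (Fin n ⊕ Unit) (Fin n ⊕ Unit) ℝ) (N : Fin n ⊕ Unit → ℝ)
    (S : Fin n ⊕ Unit → Fin n ⊕ Unit → ℝ) (ζ : Fin n ⊕ Unit → ℝ) : ℝ :=
  ∑ a, (4 * (M.mulVec ζ) a * (bilinSymbol (dM a) ζ N + bilinSymbol M ζ (S a))
    - 2 * bilinSymbol (dM a) ζ ζ * (M.mulVec N) a)

/-- The bracket `{p, φ}`. -/
def bracketSymbol (m : SpaceTime n → Matrix (Fin n ⊕ Unit) (Fin n ⊕ Unit) ℝ)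
    (φ : SpaceTime n → ℝ) (z ζ : SpaceTime n) : ℝ :=
  2 * bilinSymbol (m z) (coords ζ) (stGrad φ z)

theorem poisson_realSymbol_function (hm : ∀ z, (m z).IsSymm) (φ : SpaceTime n → ℝ) :
    poisson (realSymbol m) (fun w _ => φ w) = bracketSymbol m φ := by
  funext z ζ
  rw [bracketSymbol, bilinSymbol_comm (hm z), bilinSymbol_eq_sum_mulVec, Finset.mul_sum]
  refine Finset.sum_congr rfl fun a _ => ?_
  rw [fderiv_realSymbol_covector hm]
  simp [stGrad]
  ring

theorem differentiableAt_bracketSymbol_covector (φ : SpaceTime n → ℝ) (z ζ : SpaceTime n) :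
    DifferentiableAt ℝ (fun η => bracketSymbol m φ z η) ζ :=
  (differentiableAt_bilinSymbol_coords _ _ _).const_mul 2

theorem fderiv_bracketSymbol_covector (φ : SpaceTime n → ℝ) (z ζ : SpaceTime n)
    (a : Fin n ⊕ Unit) :
    fderiv ℝ (fun η => bracketSymbol m φ z η) ζ (coordVec a)
      = 2 * ((m z).mulVec (stGrad φ z)) a := by
  unfold bracketSymbol
  rw [fderiv_const_mul (differentiableAt_bilinSymbol_coords _ _ _),
    smul_apply, fderiv_bilinSymbol_coords_left, smul_eq_mul]

variable {φ : SpaceTime n → ℝ} {z : SpaceTime n}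

theorem differentiableAt_realSymbol_position
    (hd : ∀ b c, DifferentiableAt ℝ (fun w => m w b c) z) (ζ : SpaceTime n) :
    DifferentiableAt ℝ (fun w => realSymbol m w ζ) z :=
  differentiableAt_bilinSymbol (v := fun _ => coords ζ) (w := fun _ => coords ζ) hd
    (fun _ => differentiableAt_const _) (fun _ => differentiableAt_const _)

theorem fderiv_realSymbol_position
    (hd : ∀ b c, DifferentiableAt ℝ (fun w => m w b c) z) (ζ : SpaceTime n)
    (a : Fin n ⊕ Unit) :
    fderiv ℝ (fun w => realSymbol m w ζ) z (coordVec a)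
      = bilinSymbol (coeffDeriv m z a) (coords ζ) (coords ζ) := by
  simp only [realSymbol, quadSymbol_real]
  rw [fderiv_bilinSymbol_apply (v := fun _ => coords ζ) (w := fun _ => coords ζ) hd
    (fun _ => differentiableAt_const _) (fun _ => differentiableAt_const _)]
  simp [bilinSymbol_zero_left, bilinSymbol_zero_right, coeffDeriv]

theorem differentiableAt_bilin_coords_stGrad
    (hd : ∀ b c, DifferentiableAt ℝ (fun w => m w b c) z)
    (hφ : ∀ b, DifferentiableAt ℝ (fun w => stGrad φ w b) z) (ζ : SpaceTime n) :
    DifferentiableAt ℝ (fun w => bilinSymbol (m w) (coords ζ) (stGrad φ w)) z :=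
  differentiableAt_bilinSymbol (v := fun _ => coords ζ) hd
    (fun _ => differentiableAt_const _) hφ

theorem fderiv_bracketSymbol_position (hd : ∀ b c, DifferentiableAt ℝ (fun w => m w b c) z)
    (hφ : ∀ b, DifferentiableAt ℝ (fun w => stGrad φ w b) z) (ζ : SpaceTime n)
    (a : Fin n ⊕ Unit) :
    fderiv ℝ (fun w => bracketSymbol m φ w ζ) z (coordVec a)
      = 2 * (bilinSymbol (coeffDeriv m z a) (coords ζ) (stGrad φ z)
        + bilinSymbol (m z) (coords ζ) (stHess φ z a)) := by
  unfold bracketSymbol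
  rw [fderiv_const_mul (differentiableAt_bilin_coords_stGrad hd hφ ζ), smul_apply, smul_eq_mul,
    fderiv_bilinSymbol_apply (v := fun _ => coords ζ) hd (fun _ => differentiableAt_const _) hφ]
  have h0 : (fun b => fderiv ℝ (fun _ : SpaceTime n => coords ζ b) z (coordVec a))
      = fun _ => 0 := by
    funext b; simp
  rw [h0, bilinSymbol_zero_left, add_zero]
  rfl

theorem fderiv_symbol_stGrad (hm : ∀ z, (m z).IsSymm)
    (hd : ∀ b c, DifferentiableAt ℝ (fun w => m w b c) z)
    (hφ : ∀ b, DifferentiableAt ℝ (fun w => stGrad φ w b) z) (a : Fin n ⊕ Unit) :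
    fderiv ℝ (fun w => bilinSymbol (m w) (stGrad φ w) (stGrad φ w)) z (coordVec a)
      = bilinSymbol (coeffDeriv m z a) (stGrad φ z) (stGrad φ z)
        + 2 * bilinSymbol (m z) (stGrad φ z) (stHess φ z a) := by
  rw [fderiv_bilinSymbol_apply hd hφ hφ]
  change bilinSymbol (coeffDeriv m z a) _ _ + bilinSymbol (m z) (stHess φ z a) (stGrad φ z)
    + bilinSymbol (m z) (stGrad φ z) (stHess φ z a) = _
  rw [bilinSymbol_comm (hm z) (stHess φ z a)]
  ring

theorem poisson_bracketSymbol (hm : ∀ z, (m z).IsSymm)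
    (hd : ∀ b c, DifferentiableAt ℝ (fun w => m w b c) z)
    (hφ : ∀ b, DifferentiableAt ℝ (fun w => stGrad φ w b) z) (ζ : SpaceTime n) :
    poisson (realSymbol m) (bracketSymbol m φ) z ζ
      = doubleBracket (m z) (coeffDeriv m z) (stGrad φ z) (stHess φ z) (coords ζ) := by
  refine Finset.sum_congr rfl fun a _ => ?_
  rw [fderiv_realSymbol_covector hm, fderiv_realSymbol_position hd,
    fderiv_bracketSymbol_covector, fderiv_bracketSymbol_position hd hφ]
  ring

/-- Symmetry of the coefficients merges the two cross terms into the imaginary part, and i² = -1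
gives the sign of the σ² term. -/
theorem conjugatedSymbol_eq (hm : ∀ z, (m z).IsSymm) (φ : SpaceTime n → ℝ) (σ : ℝ)
    (z ζ : SpaceTime n) :
    conjugatedSymbol m φ σ z ζ
      = ((realSymbol m z ζ - σ ^ 2 * bilinSymbol (m z) (stGrad φ z) (stGrad φ z) : ℝ) : ℂ)
        + Complex.I * (σ : ℂ) * (bracketSymbol m φ z ζ : ℂ) := by
  unfold bracketSymbol
  have h2 : 2 * bilinSymbol (m z) (coords ζ) (stGrad φ z)
      = bilinSymbol (m z) (coords ζ) (stGrad φ z) + bilinSymbol (m z) (stGrad φ z) (coords ζ) := by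
    rw [bilinSymbol_comm (hm z) (stGrad φ z)]; ring
  rw [h2]
  simp only [conjugatedSymbol, quadSymbol, realSymbol, bilinSymbol, Complex.ofReal_add,
    Complex.ofReal_sub, Complex.ofReal_mul, Complex.ofReal_pow, Complex.ofReal_sum,
    Finset.mul_sum, ← Finset.sum_add_distrib, ← Finset.sum_sub_distrib]
  refine Finset.sum_congr rfl fun a _ => Finset.sum_congr rfl fun b _ => ?_
  simp only [RCLike.ofReal_real_eq_id, id, Complex.coe_algebraMap]
  have hI := Complex.I_sq
  linear_combination ((m z a b : ℂ) * σ ^ 2 * stGrad φ z a * stGrad φ z b) * hI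

/-- The bracket of the conjugate of `A + iσC` with `A + iσC`, for real `A` and `C`. -/
theorem poisson_conj_self {A C : SpaceTime n → SpaceTime n → ℝ} {σ : ℝ} {z ζ : SpaceTime n}
    (hAz : DifferentiableAt ℝ (fun w => A w ζ) z) (hAζ : DifferentiableAt ℝ (fun η => A z η) ζ)
    (hCz : DifferentiableAt ℝ (fun w => C w ζ) z) (hCζ : DifferentiableAt ℝ (fun η => C z η) ζ) :
    poisson (fun w η => (starRingEnd ℂ) ((A w η : ℂ) + Complex.I * (σ : ℂ) * (C w η : ℂ)))
        (fun w η => (A w η : ℂ) + Complex.I * (σ : ℂ) * (C w η : ℂ)) z ζ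
      = 2 * (Complex.I * σ) * ((poisson A C z ζ : ℝ) : ℂ) := by
  have key : ∀ (c : ℂ) {a b : SpaceTime n → ℝ} {x : SpaceTime n}, DifferentiableAt ℝ a x →
      DifferentiableAt ℝ b x → ∀ d,
      fderiv ℝ (fun y => (a y : ℂ) + c * (b y : ℂ)) x d
        = (fderiv ℝ a x d : ℂ) + c * (fderiv ℝ b x d : ℂ) := by
    intro c a b x ha hb d
    have h1 : HasFDerivAt (fun y => (a y : ℂ)) (Complex.ofRealCLM.comp (fderiv ℝ a x)) x :=
      Complex.ofRealCLM.hasFDerivAt.comp x ha.hasFDerivAt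
    have h2 : HasFDerivAt (fun y => (b y : ℂ)) (Complex.ofRealCLM.comp (fderiv ℝ b x)) x :=
      Complex.ofRealCLM.hasFDerivAt.comp x hb.hasFDerivAt
    rw [(h1.fun_add (h2.const_mul c)).fderiv]
    simp
  -- Conjugation only replaces iσ by -iσ, so `key` differentiates both arguments of the bracket.
  have hconj : ∀ w η, (starRingEnd ℂ) ((A w η : ℂ) + Complex.I * (σ : ℂ) * (C w η : ℂ))
      = (A w η : ℂ) + (-(Complex.I * (σ : ℂ))) * (C w η : ℂ) := by
    intro w η; simp
  simp only [hconj, poisson, Complex.ofReal_sum, Finset.mul_sum]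
  refine Finset.sum_congr rfl fun a _ => ?_
  rw [key _ hAz hCz, key _ hAζ hCζ, key _ hAz hCz, key _ hAζ hCζ]
  push_cast
  ring

/-- The real part of the conjugated symbol. -/
def conjugatedRe (m : SpaceTime n → Matrix (Fin n ⊕ Unit) (Fin n ⊕ Unit) ℝ)
    (φ : SpaceTime n → ℝ) (σ : ℝ) (z ζ : SpaceTime n) : ℝ :=
  realSymbol m z ζ - σ ^ 2 * bilinSymbol (m z) (stGrad φ z) (stGrad φ z)

/-- The term -σ² p(z,∇φ) does not depend on ζ, so it enters only through its z-derivative, paired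
with ∂_ζ{p,φ} = 2M∇φ. Since ∇φ is itself differentiated, the outcome is exactly the double bracket
formula evaluated at ζ = ∇φ. -/
theorem poisson_conjugatedRe (hm : ∀ z, (m z).IsSymm)
    (hd : ∀ b c, DifferentiableAt ℝ (fun w => m w b c) z)
    (hφ : ∀ b, DifferentiableAt ℝ (fun w => stGrad φ w b) z) (ζ : SpaceTime n) (σ : ℝ) :
    poisson (conjugatedRe m φ σ) (bracketSymbol m φ) z ζ
      = doubleBracket (m z) (coeffDeriv m z) (stGrad φ z) (stHess φ z) (coords ζ)
        + σ ^ 2 * doubleBracket (m z) (coeffDeriv m z) (stGrad φ z) (stHess φ z)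
            (stGrad φ z) := by
  have hr := differentiableAt_bilinSymbol hd hφ hφ
  rw [← poisson_bracketSymbol hm hd hφ, doubleBracket, Finset.mul_sum]
  unfold poisson
  rw [← Finset.sum_add_distrib]
  refine Finset.sum_congr rfl fun a _ => ?_
  have e1 : fderiv ℝ (fun η => conjugatedRe m φ σ z η) ζ (coordVec a)
      = fderiv ℝ (fun η => realSymbol m z η) ζ (coordVec a) := by
    unfold conjugatedRe
    rw [fderiv_sub_const]
  have e2 : fderiv ℝ (fun w => conjugatedRe m φ σ w ζ) z (coordVec a)
      = fderiv ℝ (fun w => realSymbol m w ζ) z (coordVec a)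
        - σ ^ 2 * (bilinSymbol (coeffDeriv m z a) (stGrad φ z) (stGrad φ z)
          + 2 * bilinSymbol (m z) (stGrad φ z) (stHess φ z a)) := by
    unfold conjugatedRe
    rw [fderiv_fun_sub (differentiableAt_realSymbol_position hd ζ) (hr.const_mul _),
      fderiv_const_mul hr, sub_apply, smul_apply, smul_eq_mul, fderiv_symbol_stGrad hm hd hφ]
  rw [e1, e2, fderiv_bracketSymbol_covector]
  ring

/-- The bracket of A - iσC with A + iσC is 2iσ{A,C}; dividing by iσ leaves the real quantity 2{A,C}.
This reduces the complex condition to two values of one real quadratic form. -/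
theorem poisson_conjugatedSymbol (hm : ∀ z, (m z).IsSymm)
    (hd : ∀ b c, DifferentiableAt ℝ (fun w => m w b c) z)
    (hφ : ∀ b, DifferentiableAt ℝ (fun w => stGrad φ w b) z) (ζ : SpaceTime n) {σ : ℝ}
    (hσ : σ ≠ 0) :
    (poisson (fun w η => (starRingEnd ℂ) (conjugatedSymbol m φ σ w η))
          (conjugatedSymbol m φ σ) z ζ / (Complex.I * (σ : ℂ))).re
      = 2 * (doubleBracket (m z) (coeffDeriv m z) (stGrad φ z) (stHess φ z) (coords ζ)
        + σ ^ 2 * doubleBracket (m z) (coeffDeriv m z) (stGrad φ z) (stHess φ z)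
            (stGrad φ z)) := by
  have hfun : conjugatedSymbol m φ σ = fun w η => (conjugatedRe m φ σ w η : ℂ)
      + Complex.I * (σ : ℂ) * (bracketSymbol m φ w η : ℂ) := by
    funext w η; exact conjugatedSymbol_eq hm φ σ w η
  rw [hfun, poisson_conj_self
    ((differentiableAt_realSymbol_position hd ζ).sub
      ((differentiableAt_bilinSymbol hd hφ hφ).const_mul _))
    ((differentiableAt_realSymbol_covector z ζ).sub (differentiableAt_const _))
    ((differentiableAt_bilin_coords_stGrad hd hφ ζ).const_mul 2)
    (differentiableAt_bracketSymbol_covector φ z ζ), poisson_conjugatedRe hm hd hφ]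
  have hne : (Complex.I * (σ : ℂ)) ≠ 0 :=
    mul_ne_zero Complex.I_ne_zero (Complex.ofReal_ne_zero.mpr hσ)
  rw [mul_comm (2 : ℂ), mul_assoc, mul_div_cancel_left₀ _ hne, ← Complex.ofReal_ofNat,
    ← Complex.ofReal_mul, Complex.ofReal_re]

end Bracket

/-! ### The wave symbol, Christoffel symbols and the Lorentzian Hessian -/

section Metric

variable {n : ℕ}

theorem contDiff_det_of_entries {E : Type*} [NormedAddCommGroup E] [NormedSpace ℝ E]
    {k : WithTop ℕ∞} {A : E → Matrix (Fin n) (Fin n) ℝ}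
    (hA : ∀ i j, ContDiff ℝ k (fun x => A x i j)) : ContDiff ℝ k (fun x => (A x).det) := by
  simp only [Matrix.det_apply']
  exact ContDiff.sum fun σ _ => contDiff_const.mul (contDiff_prod fun i _ => hA _ _)

/-- Cramer's rule: an adjugate entry is the determinant of the matrix with one row replaced by a
constant basis vector. -/
theorem contDiff_inv_of_entries {E : Type*} [NormedAddCommGroup E] [NormedSpace ℝ E]
    {k : WithTop ℕ∞} {A : E → Matrix (Fin n) (Fin n) ℝ}
    (hA : ∀ i j, ContDiff ℝ k (fun x => A x i j)) (hdet : ∀ x, (A x).det ≠ 0) (i j : Fin n) :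
    ContDiff ℝ k (fun x => (A x)⁻¹ i j) := by
  simp only [Matrix.inv_def, Ring.inverse_eq_inv', Matrix.smul_apply, smul_eq_mul,
    Matrix.adjugate_apply]
  refine ((contDiff_det_of_entries hA).inv hdet).mul (contDiff_det_of_entries fun a b => ?_)
  by_cases h : a = j
  · subst h; simpa using contDiff_const
  · simpa [Matrix.updateRow_ne h] using hA a b

namespace SmoothMetric

variable (g : SmoothMetric n)

theorem det_ne_zero (x : Space n) : (g.coeff x).det ≠ 0 := (g.posDef x).det_pos.ne'

theorem contDiff_inv (i j : Fin n) :
    ContDiff ℝ ((⊤ : ℕ∞) : WithTop ℕ∞) (fun x => (g.coeff x)⁻¹ i j) :=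
  contDiff_inv_of_entries g.smooth g.det_ne_zero i j

theorem inv_posDef (x : Space n) : ((g.coeff x)⁻¹).PosDef := (g.posDef x).inv

theorem coeff_isSymm (x : Space n) : (g.coeff x).IsSymm := by
  simpa [Matrix.IsHermitian, Matrix.IsSymm] using (g.posDef x).isHermitian

theorem inv_isSymm (x : Space n) : ((g.coeff x)⁻¹).IsSymm := by
  simpa [Matrix.IsHermitian, Matrix.IsSymm] using (g.inv_posDef x).isHermitian

/-- The matrix `∂_j g`. -/
def deriv (j : Fin n) (x : Space n) : Matrix (Fin n) (Fin n) ℝ :=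
  Matrix.of fun l k => partialD j (fun y => g.coeff y l k) x

/-- The matrix `∂_j g⁻¹`. -/
def derivInv (j : Fin n) (x : Space n) : Matrix (Fin n) (Fin n) ℝ :=
  Matrix.of fun l k => partialD j (fun y => (g.coeff y)⁻¹ l k) x

/-- Obtained by differentiating g⁻¹g = 1 entrywise and multiplying by g⁻¹ on the right. -/
theorem derivInv_eq (j : Fin n) (x : Space n) :
    g.derivInv j x = -((g.coeff x)⁻¹ * g.deriv j x * (g.coeff x)⁻¹) := by
  have hu : IsUnit (g.coeff x).det := isUnit_iff_ne_zero.mpr (g.det_ne_zero x)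
  have h : g.derivInv j x * g.coeff x + (g.coeff x)⁻¹ * g.deriv j x = 0 := by
    ext a b
    have hc : (fun y => ∑ l, (g.coeff y)⁻¹ a l * g.coeff y l b)
        = fun _ => (1 : Matrix (Fin n) (Fin n) ℝ) a b := by
      funext y
      rw [← Matrix.mul_apply,
        Matrix.nonsing_inv_mul _ (isUnit_iff_ne_zero.mpr (g.det_ne_zero y))]
    have hi : ∀ l, DifferentiableAt ℝ (fun y => (g.coeff y)⁻¹ a l) x := fun l =>
      ((g.contDiff_inv a l).differentiable (by simp)) x
    have hg : ∀ l, DifferentiableAt ℝ (fun y => g.coeff y l b) x := fun l =>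
      ((g.smooth l b).differentiable (by simp)) x
    have hd := congrArg (fun f => fderiv ℝ f x (EuclideanSpace.single j 1)) hc
    simp only [fderiv_fun_const, Pi.zero_apply, zero_apply] at hd
    rw [fderiv_fun_sum (fun l _ => (hi l).fun_mul (hg l))] at hd
    simp only [sum_apply, fderiv_fun_mul (hi _) (hg _), add_apply, smul_apply,
      smul_eq_mul] at hd
    rw [Matrix.add_apply, Matrix.mul_apply, Matrix.mul_apply, Matrix.zero_apply, ← hd,
      ← Finset.sum_add_distrib]
    refine Finset.sum_congr rfl fun l _ => ?_
    simp only [derivInv, deriv, partialD, Matrix.of_apply]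
    ring
  calc g.derivInv j x = g.derivInv j x * g.coeff x * (g.coeff x)⁻¹ := by
        rw [Matrix.mul_assoc, Matrix.mul_nonsing_inv _ hu, Matrix.mul_one]
    _ = _ := by rw [eq_neg_of_add_eq_zero_left h, Matrix.neg_mul]

end SmoothMetric

theorem bilinSymbol_eq_dotProduct {ι : Type*} [Fintype ι] (m : Matrix ι ι ℝ) (v w : ι → ℝ) :
    bilinSymbol m v w = v ⬝ᵥ m.mulVec w := by
  simp [bilinSymbol_eq_sum_mulVec, dotProduct, mul_comm]

/-- Trades derivatives of g⁻¹ at covectors for derivatives of g at the velocities g⁻¹v, the form in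
which Christoffel symbols appear. -/
theorem SmoothMetric.bilinSymbol_derivInv (g : SmoothMetric n) (j : Fin n) (x : Space n)
    (v w : Fin n → ℝ) :
    bilinSymbol (g.derivInv j x) v w
      = -bilinSymbol (g.deriv j x) ((g.coeff x)⁻¹.mulVec v) ((g.coeff x)⁻¹.mulVec w) := by
  rw [bilinSymbol_eq_dotProduct, bilinSymbol_eq_dotProduct, g.derivInv_eq, Matrix.neg_mulVec,
    dotProduct_neg, ← Matrix.mulVec_mulVec, ← Matrix.mulVec_mulVec, Matrix.dotProduct_mulVec,
    ← Matrix.mulVec_transpose, (g.inv_isSymm x).eq]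

/-- The covariant Hessian, computed from a gradient `ν` and a matrix `A` of second derivatives. -/
def covariantHess (g : SmoothMetric n) (x : Space n) (A : Matrix (Fin n) (Fin n) ℝ)
    (ν : Fin n → ℝ) : Matrix (Fin n) (Fin n) ℝ :=
  Matrix.of fun j k => A j k - ∑ i, christoffel g i j k x * ν i

theorem sum_christoffel (g : SmoothMetric n) (x : Space n) (ν : Fin n → ℝ) (j k : Fin n) :
    ∑ i, christoffel g i j k x * ν i = (1 / 2) * ∑ l, ((g.coeff x)⁻¹.mulVec ν) l *
      (g.deriv j x l k + g.deriv k x l j - g.deriv l x j k) := by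
  simp only [christoffel, Matrix.mulVec, dotProduct, Finset.mul_sum, Finset.sum_mul]
  rw [Finset.sum_comm]
  refine Finset.sum_congr rfl fun l _ => Finset.sum_congr rfl fun i _ => ?_
  rw [(g.inv_isSymm x).apply]
  simp only [SmoothMetric.deriv, Matrix.of_apply]
  ring

/-- With Y = g⁻¹ν, put A = Σ Y_l ∂_j g_{lk} X_j X_k and B = Σ Y_l ∂_l g_{jk} X_j X_k. The first two
Christoffel terms both contract to A after exchanging j and k, the third to B, and each side is 4A -
2B. This is why the coordinate bracket produces a covariant Hessian. -/
theorem sum_deriv_bilin_eq_christoffel (g : SmoothMetric n) (x : Space n) (X ν : Fin n → ℝ) :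
    ∑ j, (4 * X j * bilinSymbol (g.deriv j x) X ((g.coeff x)⁻¹.mulVec ν)
      - 2 * bilinSymbol (g.deriv j x) X X * ((g.coeff x)⁻¹.mulVec ν) j)
      = 4 * bilinSymbol (Matrix.of fun j k => ∑ i, christoffel g i j k x * ν i) X X := by
  set Y := (g.coeff x)⁻¹.mulVec ν with hY
  have hs : ∀ j l k, g.deriv j x l k = g.deriv j x k l := fun j l k => by
    simp only [SmoothMetric.deriv, Matrix.of_apply]
    congr 1; funext y; exact (g.coeff_isSymm y).apply _ _
  have h1 : bilinSymbol (Matrix.of fun j k => ∑ i, christoffel g i j k x * ν i) X X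
      = (1 / 2) * (∑ j, ∑ k, ∑ l, Y l * g.deriv j x l k * X j * X k)
        + (1 / 2) * (∑ j, ∑ k, ∑ l, Y l * g.deriv k x l j * X j * X k)
        - (1 / 2) * (∑ j, ∑ k, ∑ l, Y l * g.deriv l x j k * X j * X k) := by
    simp only [bilinSymbol, Matrix.of_apply, sum_christoffel, ← hY, Finset.mul_sum,
      Finset.sum_mul, ← Finset.sum_add_distrib, ← Finset.sum_sub_distrib]
    refine Finset.sum_congr rfl fun j _ => Finset.sum_congr rfl fun k _ =>
      Finset.sum_congr rfl fun l _ => ?_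
    ring
  have h2 : ∑ j, ∑ k, ∑ l, Y l * g.deriv k x l j * X j * X k
      = ∑ j, ∑ k, ∑ l, Y l * g.deriv j x l k * X j * X k := by
    rw [Finset.sum_comm]
    refine Finset.sum_congr rfl fun j _ => Finset.sum_congr rfl fun k _ =>
      Finset.sum_congr rfl fun l _ => ?_
    ring
  have h3 : ∑ j, X j * bilinSymbol (g.deriv j x) X Y
      = ∑ j, ∑ k, ∑ l, Y l * g.deriv j x l k * X j * X k := by
    simp only [bilinSymbol, Finset.mul_sum]
    refine Finset.sum_congr rfl fun j _ => Finset.sum_congr rfl fun k _ =>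
      Finset.sum_congr rfl fun l _ => ?_
    rw [hs j l k]; ring
  have h4 : ∑ l, bilinSymbol (g.deriv l x) X X * Y l
      = ∑ j, ∑ k, ∑ l, Y l * g.deriv l x j k * X j * X k := by
    simp only [bilinSymbol, Finset.sum_mul]
    rw [Finset.sum_comm]
    refine Finset.sum_congr rfl fun j _ => ?_
    rw [Finset.sum_comm]
    refine Finset.sum_congr rfl fun k _ => Finset.sum_congr rfl fun l _ => ?_
    ring
  rw [h1, h2, ← h3, ← h4, Finset.sum_sub_distrib]
  simp only [mul_assoc, ← Finset.mul_sum]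
  ring

theorem boxSymbol_isSymm (g : SmoothMetric n) (z : SpaceTime n) : (boxSymbol g z).IsSymm := by
  refine Matrix.IsSymm.fromBlocks (g.inv_isSymm _) (by simp) ?_
  simp [Matrix.IsSymm]

theorem boxSymbol_mulVec_inl (g : SmoothMetric n) (z : SpaceTime n) (ζ : Fin n ⊕ Unit → ℝ)
    (j : Fin n) :
    (boxSymbol g z).mulVec ζ (Sum.inl j) = ((g.coeff z.1)⁻¹.mulVec fun k => ζ (Sum.inl k)) j := by
  simp [boxSymbol, Matrix.fromBlocks_mulVec, Function.comp_def]

theorem boxSymbol_mulVec_inr (g : SmoothMetric n) (z : SpaceTime n) (ζ : Fin n ⊕ Unit → ℝ) :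
    (boxSymbol g z).mulVec ζ (Sum.inr ()) = -ζ (Sum.inr ()) := by
  simp [boxSymbol, Matrix.fromBlocks_mulVec, Matrix.neg_mulVec]

theorem differentiableAt_boxSymbol (g : SmoothMetric n) (z : SpaceTime n) (b c : Fin n ⊕ Unit) :
    DifferentiableAt ℝ (fun w => boxSymbol g w b c) z := by
  rcases b with j | _ <;> rcases c with k | _ <;> simp only [boxSymbol, Matrix.fromBlocks_apply₁₁,
    Matrix.fromBlocks_apply₁₂, Matrix.fromBlocks_apply₂₁, Matrix.fromBlocks_apply₂₂]
  · exact (((g.contDiff_inv j k).differentiable (by simp)) z.1).comp z differentiableAt_fst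
  all_goals exact differentiableAt_const _

/-- Derivatives of functions of `x` alone along the coordinate directions of space-time. -/
theorem fderiv_comp_fst_inl {f : Space n → ℝ} {z : SpaceTime n} (hf : DifferentiableAt ℝ f z.1)
    (j : Fin n) :
    fderiv ℝ (fun w : SpaceTime n => f w.1) z (coordVec (Sum.inl j)) = partialD j f z.1 := by
  have h : HasFDerivAt (fun w : SpaceTime n => f w.1)
      ((fderiv ℝ f z.1).comp (ContinuousLinearMap.fst ℝ (Space n) ℝ)) z :=
    hf.hasFDerivAt.comp z hasFDerivAt_fst
  rw [h.fderiv]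
  simp [coordVec, partialD]

theorem fderiv_comp_fst_inr {f : Space n → ℝ} {z : SpaceTime n} (hf : DifferentiableAt ℝ f z.1) :
    fderiv ℝ (fun w : SpaceTime n => f w.1) z (coordVec (Sum.inr ())) = 0 := by
  have h : HasFDerivAt (fun w : SpaceTime n => f w.1)
      ((fderiv ℝ f z.1).comp (ContinuousLinearMap.fst ℝ (Space n) ℝ)) z :=
    hf.hasFDerivAt.comp z hasFDerivAt_fst
  rw [h.fderiv]
  simp [coordVec]

theorem coeffDeriv_boxSymbol_inl (g : SmoothMetric n) (z : SpaceTime n) (j : Fin n) :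
    coeffDeriv (boxSymbol g) z (Sum.inl j) = Matrix.fromBlocks (g.derivInv j z.1) 0 0 0 := by
  ext b c
  rcases b with b | _ <;> rcases c with c | _ <;> simp only [coeffDeriv, Matrix.of_apply,
    boxSymbol, Matrix.fromBlocks_apply₁₁,
    Matrix.fromBlocks_apply₁₂, Matrix.fromBlocks_apply₂₁, Matrix.fromBlocks_apply₂₂]
  · exact fderiv_comp_fst_inl (f := fun y => (g.coeff y)⁻¹ b c)
      (((g.contDiff_inv b c).differentiable (by simp)) z.1) j
  all_goals simp

theorem coeffDeriv_boxSymbol_inr (g : SmoothMetric n) (z : SpaceTime n) :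
    coeffDeriv (boxSymbol g) z (Sum.inr ()) = 0 := by
  ext b c
  rcases b with b | _ <;> rcases c with c | _ <;> simp only [coeffDeriv, Matrix.of_apply,
    boxSymbol, Matrix.fromBlocks_apply₁₁,
    Matrix.fromBlocks_apply₁₂, Matrix.fromBlocks_apply₂₁, Matrix.fromBlocks_apply₂₂]
  · exact fderiv_comp_fst_inr (f := fun y => (g.coeff y)⁻¹ b c)
      (((g.contDiff_inv b c).differentiable (by simp)) z.1)
  all_goals simp

theorem bilinSymbol_fromBlocks_zero (A : Matrix (Fin n) (Fin n) ℝ) (v w : Fin n ⊕ Unit → ℝ) :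
    bilinSymbol (Matrix.fromBlocks A 0 0 0) v w
      = bilinSymbol A (fun k => v (Sum.inl k)) (fun k => w (Sum.inl k)) := by
  simp [bilinSymbol]

theorem bilinSymbol_boxSymbol (g : SmoothMetric n) (z : SpaceTime n) (v w : Fin n ⊕ Unit → ℝ) :
    bilinSymbol (boxSymbol g z) v w
      = bilinSymbol (g.coeff z.1)⁻¹ (fun k => v (Sum.inl k)) (fun k => w (Sum.inl k))
        - v (Sum.inr ()) * w (Sum.inr ()) := by
  simp [bilinSymbol, boxSymbol, sub_eq_add_neg]

/-- The double bracket of the wave symbol is the Lorentzian Hessian at the velocity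
`(X, -τ) = (g⁻¹ξ, -τ)`. -/
theorem doubleBracket_boxSymbol (g : SmoothMetric n) (z : SpaceTime n) (N : Fin n ⊕ Unit → ℝ)
    (S : Fin n ⊕ Unit → Fin n ⊕ Unit → ℝ) (ζ : Fin n ⊕ Unit → ℝ) {X : Fin n → ℝ}
    (hX : X = (g.coeff z.1)⁻¹.mulVec fun k => ζ (Sum.inl k)) :
    doubleBracket (boxSymbol g z) (coeffDeriv (boxSymbol g) z) N S ζ
      = 4 * (bilinSymbol (covariantHess g z.1 (Matrix.of fun j k => S (Sum.inl j) (Sum.inl k))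
          fun i => N (Sum.inl i)) X X
        - ζ (Sum.inr ()) * ∑ j, (S (Sum.inl j) (Sum.inr ()) + S (Sum.inr ()) (Sum.inl j)) * X j
        + S (Sum.inr ()) (Sum.inr ()) * ζ (Sum.inr ()) ^ 2) := by
  set τ := ζ (Sum.inr ())
  have hMS : ∀ a, bilinSymbol (boxSymbol g z) ζ (S a)
      = ∑ k, X k * S a (Sum.inl k) - τ * S a (Sum.inr ()) := by
    intro a
    rw [bilinSymbol_boxSymbol, bilinSymbol_comm (g.inv_isSymm _), bilinSymbol_eq_sum_mulVec, hX]
  have hΓ := sum_deriv_bilin_eq_christoffel g z.1 X (fun i => N (Sum.inl i))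
  have hcov : bilinSymbol (covariantHess g z.1
      (Matrix.of fun j k => S (Sum.inl j) (Sum.inl k)) fun i => N (Sum.inl i)) X X
      = (∑ j, ∑ k, S (Sum.inl j) (Sum.inl k) * X j * X k)
        - bilinSymbol (Matrix.of fun j k => ∑ i, christoffel g i j k z.1 * N (Sum.inl i)) X X := by
    simp only [bilinSymbol, covariantHess, Matrix.of_apply, sub_mul, Finset.sum_sub_distrib]
  rw [hcov]
  have hz : ∀ v w : Fin n ⊕ Unit → ℝ, bilinSymbol (0 : Matrix _ _ ℝ) v w = 0 := fun v w => by
    simp [bilinSymbol]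
  unfold doubleBracket
  rw [Fintype.sum_sum_type]
  simp only [Finset.univ_unique, Finset.sum_singleton, PUnit.default_eq_unit,
    boxSymbol_mulVec_inl, boxSymbol_mulVec_inr,
    coeffDeriv_boxSymbol_inl, coeffDeriv_boxSymbol_inr, bilinSymbol_fromBlocks_zero, hMS, hz,
    g.bilinSymbol_derivInv, ← hX]
  have hsum : ∀ j, ∑ k, S (Sum.inl j) (Sum.inl k) * X j * X k
      = X j * ∑ k, X k * S (Sum.inl j) (Sum.inl k) := fun j => by
    rw [Finset.mul_sum]
    exact Finset.sum_congr rfl fun k _ => by ring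
  have hsplit : ∑ j, (S (Sum.inl j) (Sum.inr ()) + S (Sum.inr ()) (Sum.inl j)) * X j
      = ∑ j, X j * S (Sum.inl j) (Sum.inr ()) + ∑ j, X j * S (Sum.inr ()) (Sum.inl j) := by
    rw [← Finset.sum_add_distrib]
    exact Finset.sum_congr rfl fun j _ => by ring
  rw [hsplit]
  simp only [hsum]
  -- The minus signs from ∂g⁻¹ = -g⁻¹(∂g)g⁻¹ make the metric derivatives enter as minus the
  -- Christoffel sum `hΓ`, matching the correction in `covariantHess`.
  have hmain : ∑ j, (4 * X j *
            (-bilinSymbol (g.deriv j z.1) X ((g.coeff z.1)⁻¹.mulVec fun k => N (Sum.inl k)) +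
              (∑ k, X k * S (Sum.inl j) (Sum.inl k) - τ * S (Sum.inl j) (Sum.inr ()))) -
          2 * -bilinSymbol (g.deriv j z.1) X X * (g.coeff z.1)⁻¹.mulVec (fun k => N (Sum.inl k)) j)
      = 4 * ∑ j, X j * ∑ k, X k * S (Sum.inl j) (Sum.inl k)
        - ∑ j, (4 * X j * bilinSymbol (g.deriv j z.1) X
              ((g.coeff z.1)⁻¹.mulVec fun i => N (Sum.inl i)) -
            2 * bilinSymbol (g.deriv j z.1) X X *
              (g.coeff z.1)⁻¹.mulVec (fun i => N (Sum.inl i)) j)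
        - 4 * τ * ∑ j, X j * S (Sum.inl j) (Sum.inr ()) := by
    rw [Finset.mul_sum, Finset.mul_sum, ← Finset.sum_sub_distrib, ← Finset.sum_sub_distrib]
    exact Finset.sum_congr rfl fun j _ => by ring
  rw [hmain]
  linear_combination -hΓ

end Metric

/-! ### Exponentiating a phase -/

section Exponential

variable {n : ℕ}

theorem stGrad_exp {Φ : SpaceTime n → ℝ} {w : SpaceTime n} (hΦ : DifferentiableAt ℝ Φ w)
    (lam : ℝ) (a : Fin n ⊕ Unit) :
    stGrad (fun y => Real.exp (lam * Φ y)) w a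
      = lam * Real.exp (lam * Φ w) * stGrad Φ w a := by
  unfold stGrad
  rw [((hΦ.hasFDerivAt.const_mul lam).exp).fderiv]
  simp only [smul_apply, smul_eq_mul]
  ring

/-- The chain-rule formula for the gradient is needed on a neighbourhood, not only at z, since it is
differentiated again. -/
theorem differentiableAt_stGrad_exp {Φ : SpaceTime n → ℝ} {z : SpaceTime n}
    (hΦ : ∀ᶠ w in 𝓝 z, DifferentiableAt ℝ Φ w)
    (hG : ∀ b, DifferentiableAt ℝ (fun w => stGrad Φ w b) z) (lam : ℝ) (b : Fin n ⊕ Unit) :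
    DifferentiableAt ℝ (fun w => stGrad (fun y => Real.exp (lam * Φ y)) w b) z := by
  have h : (fun w => stGrad (fun y => Real.exp (lam * Φ y)) w b)
      =ᶠ[𝓝 z] fun w => lam * Real.exp (lam * Φ w) * stGrad Φ w b := by
    filter_upwards [hΦ] with w hw using stGrad_exp hw lam b
  rw [h.differentiableAt_iff]
  exact (((hΦ.self_of_nhds.const_mul lam).exp).const_mul lam).mul (hG b)

theorem stHess_exp {Φ : SpaceTime n → ℝ} {z : SpaceTime n}
    (hΦ : ∀ᶠ w in 𝓝 z, DifferentiableAt ℝ Φ w)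
    (hG : ∀ b, DifferentiableAt ℝ (fun w => stGrad Φ w b) z) (lam : ℝ) (a b : Fin n ⊕ Unit) :
    stHess (fun y => Real.exp (lam * Φ y)) z a b
      = lam * Real.exp (lam * Φ z) * (stHess Φ z a b + lam * (stGrad Φ z a * stGrad Φ z b)) := by
  have h : (fun w => stGrad (fun y => Real.exp (lam * Φ y)) w b)
      =ᶠ[𝓝 z] fun w => lam * Real.exp (lam * Φ w) * stGrad Φ w b := by
    filter_upwards [hΦ] with w hw using stGrad_exp hw lam b
  unfold stHess
  rw [h.fderiv_eq, ((((hΦ.self_of_nhds.hasFDerivAt.const_mul lam).exp).const_mul lam).fun_mul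
    (hG b).hasFDerivAt).fderiv]
  simp only [add_apply, smul_apply, smul_eq_mul]
  change _ = lam * Real.exp (lam * Φ z) * (_ + lam * (fderiv ℝ Φ z (coordVec a) * _))
  ring

/-- D is linear in the pair (gradient, Hessian), so the factor c comes out; the rank-one part λ N⊗N
of the Hessian contributes 4λ M(ζ,N)², which is nonnegative for λ ≥ 0. -/
theorem doubleBracket_exp {M : Matrix (Fin n ⊕ Unit) (Fin n ⊕ Unit) ℝ} (hM : M.IsSymm)
    (dM : Fin n ⊕ Unit → Matrix (Fin n ⊕ Unit) (Fin n ⊕ Unit) ℝ) (N : Fin n ⊕ Unit → ℝ)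
    (S : Fin n ⊕ Unit → Fin n ⊕ Unit → ℝ) (ζ : Fin n ⊕ Unit → ℝ) (c lam : ℝ) :
    doubleBracket M dM (c • N) (fun a b => c * (S a b + lam * (N a * N b))) ζ
      = c * (doubleBracket M dM N S ζ + 4 * lam * bilinSymbol M ζ N ^ 2) := by
  have h1 : ∀ A : Matrix (Fin n ⊕ Unit) (Fin n ⊕ Unit) ℝ,
      bilinSymbol A ζ (c • N) = c * bilinSymbol A ζ N := fun A => by
    simp [bilinSymbol_eq_dotProduct, Matrix.mulVec_smul]
  have h2 : ∀ a, bilinSymbol M ζ (fun b => c * (S a b + lam * (N a * N b)))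
      = c * (bilinSymbol M ζ (S a) + lam * (N a * bilinSymbol M ζ N)) := fun a => by
    have : (fun b => c * (S a b + lam * (N a * N b))) = c • (S a + (lam * N a) • N) := by
      funext b; simp only [Pi.smul_apply, Pi.add_apply, smul_eq_mul]; ring
    rw [this]
    simp [bilinSymbol_eq_dotProduct, Matrix.mulVec_smul, Matrix.mulVec_add, dotProduct_add]
    ring
  have h3 : bilinSymbol M ζ N ^ 2 = ∑ a, (M.mulVec ζ) a * N a * bilinSymbol M ζ N := by
    rw [← Finset.sum_mul, ← bilinSymbol_eq_sum_mulVec, bilinSymbol_comm hM N, sq]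
  rw [h3]
  unfold doubleBracket
  rw [Finset.mul_sum, ← Finset.sum_add_distrib, Finset.mul_sum]
  refine Finset.sum_congr rfl fun a _ => ?_
  simp only [h1, h2, Matrix.mulVec_smul, Pi.smul_apply, smul_eq_mul]
  ring

end Exponential

/-! ### Derivatives and double bracket of the phase -/

section Phase

variable {n : ℕ} {U : Set (Space n)} {ψ ω : Space n → ℝ} {ι : ℝ} {z : SpaceTime n}

theorem hasFDerivAt_comp_fst {f : Space n → ℝ} (hf : DifferentiableAt ℝ f z.1) :
    HasFDerivAt (fun w : SpaceTime n => f w.1)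
      ((fderiv ℝ f z.1).comp (ContinuousLinearMap.fst ℝ (Space n) ℝ)) z :=
  hf.hasFDerivAt.comp z hasFDerivAt_fst

theorem hasFDerivAt_phase (hψ : DifferentiableAt ℝ ψ z.1) (hω : DifferentiableAt ℝ ω z.1) :
    HasFDerivAt (phase ι ψ ω)
      ((ι * Real.exp (ι * ψ z.1)) • (fderiv ℝ ψ z.1).comp (ContinuousLinearMap.fst ℝ (Space n) ℝ)
        - (z.2 - ω z.1) • (ContinuousLinearMap.snd ℝ (Space n) ℝ
          - (fderiv ℝ ω z.1).comp (ContinuousLinearMap.fst ℝ (Space n) ℝ))) z := by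
  have h1 := ((hasFDerivAt_comp_fst hψ).const_mul ι).exp
  have h2 := ((hasFDerivAt_snd (𝕜 := ℝ) (p := z)).fun_sub (hasFDerivAt_comp_fst hω))
  have h3 := h1.fun_sub ((h2.pow 2).mul_const (1 / 2))
  have hfun : phase ι ψ ω = fun w : SpaceTime n =>
      Real.exp (ι * ψ w.1) - (w.2 - ω w.1) ^ 2 * (1 / 2) := by
    funext w; simp only [phase]; ring
  rw [hfun]
  refine h3.congr_fderiv ?_
  ext v <;> simp
  ring

theorem stGrad_phase_inl (hψ : DifferentiableAt ℝ ψ z.1) (hω : DifferentiableAt ℝ ω z.1)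
    (j : Fin n) :
    stGrad (phase ι ψ ω) z (Sum.inl j)
      = ι * Real.exp (ι * ψ z.1) * partialD j ψ z.1 + (z.2 - ω z.1) * partialD j ω z.1 := by
  unfold stGrad
  rw [(hasFDerivAt_phase hψ hω).fderiv]
  simp [coordVec, partialD]

theorem stGrad_phase_inr (hψ : DifferentiableAt ℝ ψ z.1) (hω : DifferentiableAt ℝ ω z.1) :
    stGrad (phase ι ψ ω) z (Sum.inr ()) = -(z.2 - ω z.1) := by
  unfold stGrad
  rw [(hasFDerivAt_phase hψ hω).fderiv]
  simp [coordVec]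

theorem contDiffOn_partialD {f : Space n → ℝ} (hU : IsOpen U) (hf : ContDiffOn ℝ 2 f U)
    (j : Fin n) : ContDiffOn ℝ 1 (partialD j f) U :=
  (hf.fderiv_of_isOpen hU (by norm_num)).clm_apply contDiffOn_const

theorem differentiableAt_of_contDiffOn {f : Space n → ℝ} {k : WithTop ℕ∞} (hk : k ≠ 0)
    (hU : IsOpen U) (hf : ContDiffOn ℝ k f U) {x : Space n} (hx : x ∈ U) :
    DifferentiableAt ℝ f x :=
  (hf.contDiffAt (hU.mem_nhds hx)).differentiableAt hk

theorem eventually_fst_mem (hU : IsOpen U) (hz : z.1 ∈ U) :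
    ∀ᶠ w : SpaceTime n in 𝓝 z, w.1 ∈ U :=
  continuous_fst.continuousAt.eventually (hU.mem_nhds hz)

theorem eventually_differentiableAt_phase (hU : IsOpen U) (hψ : ContDiffOn ℝ 2 ψ U) (hω : ContDiffOn ℝ 2 ω U) (hz : z.1 ∈ U) :
    ∀ᶠ w in 𝓝 z, DifferentiableAt ℝ (phase ι ψ ω) w := by
  filter_upwards [eventually_fst_mem hU hz] with w hw
  exact (hasFDerivAt_phase (differentiableAt_of_contDiffOn two_ne_zero hU hψ hw)
    (differentiableAt_of_contDiffOn two_ne_zero hU hω hw)).differentiableAt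

theorem hasFDerivAt_stGrad_phase_inl (hU : IsOpen U) (hψ : ContDiffOn ℝ 2 ψ U) (hω : ContDiffOn ℝ 2 ω U) (hz : z.1 ∈ U)
    (k : Fin n) :
    HasFDerivAt (fun w => stGrad (phase ι ψ ω) w (Sum.inl k))
      ((ι * Real.exp (ι * ψ z.1)) • (fderiv ℝ (partialD k ψ) z.1).comp
          (ContinuousLinearMap.fst ℝ (Space n) ℝ)
        + (ι ^ 2 * Real.exp (ι * ψ z.1) * partialD k ψ z.1) • (fderiv ℝ ψ z.1).comp
          (ContinuousLinearMap.fst ℝ (Space n) ℝ)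
        + (z.2 - ω z.1) • (fderiv ℝ (partialD k ω) z.1).comp
          (ContinuousLinearMap.fst ℝ (Space n) ℝ)
        + partialD k ω z.1 • (ContinuousLinearMap.snd ℝ (Space n) ℝ
          - (fderiv ℝ ω z.1).comp (ContinuousLinearMap.fst ℝ (Space n) ℝ))) z := by
  have h : (fun w => stGrad (phase ι ψ ω) w (Sum.inl k)) =ᶠ[𝓝 z] fun w =>
      ι * Real.exp (ι * ψ w.1) * partialD k ψ w.1 + (w.2 - ω w.1) * partialD k ω w.1 := by
    filter_upwards [eventually_fst_mem hU hz] with w hw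
    exact stGrad_phase_inl (differentiableAt_of_contDiffOn two_ne_zero hU hψ hw)
      (differentiableAt_of_contDiffOn two_ne_zero hU hω hw) k
  refine HasFDerivAt.congr_of_eventuallyEq ?_ h
  have dψ := hasFDerivAt_comp_fst (differentiableAt_of_contDiffOn two_ne_zero hU hψ hz)
  have dω := hasFDerivAt_comp_fst (differentiableAt_of_contDiffOn two_ne_zero hU hω hz)
  have dψk := hasFDerivAt_comp_fst
    (differentiableAt_of_contDiffOn one_ne_zero hU (contDiffOn_partialD hU hψ k) hz)
  have dωk := hasFDerivAt_comp_fst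
    (differentiableAt_of_contDiffOn one_ne_zero hU (contDiffOn_partialD hU hω k) hz)
  refine (((((dψ.const_mul ι).exp).const_mul ι).fun_mul dψk).fun_add
    (((hasFDerivAt_snd (𝕜 := ℝ) (p := z)).fun_sub dω).fun_mul dωk)).congr_fderiv ?_
  ext v <;> simp
  ring

theorem hasFDerivAt_stGrad_phase_inr (hU : IsOpen U) (hψ : ContDiffOn ℝ 2 ψ U) (hω : ContDiffOn ℝ 2 ω U) (hz : z.1 ∈ U) :
    HasFDerivAt (fun w => stGrad (phase ι ψ ω) w (Sum.inr ()))
      (-(ContinuousLinearMap.snd ℝ (Space n) ℝ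
          - (fderiv ℝ ω z.1).comp (ContinuousLinearMap.fst ℝ (Space n) ℝ))) z := by
  have h : (fun w => stGrad (phase ι ψ ω) w (Sum.inr ())) =ᶠ[𝓝 z] fun w =>
      -(w.2 - ω w.1) := by
    filter_upwards [eventually_fst_mem hU hz] with w hw
    exact stGrad_phase_inr (differentiableAt_of_contDiffOn two_ne_zero hU hψ hw)
      (differentiableAt_of_contDiffOn two_ne_zero hU hω hw)
  refine HasFDerivAt.congr_of_eventuallyEq ?_ h
  exact ((hasFDerivAt_snd (𝕜 := ℝ) (p := z)).fun_sub
    (hasFDerivAt_comp_fst (differentiableAt_of_contDiffOn two_ne_zero hU hω hz))).fun_neg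

theorem differentiableAt_stGrad_phase (hU : IsOpen U) (hψ : ContDiffOn ℝ 2 ψ U) (hω : ContDiffOn ℝ 2 ω U) (hz : z.1 ∈ U)
    (b : Fin n ⊕ Unit) :
    DifferentiableAt ℝ (fun w => stGrad (phase ι ψ ω) w b) z := by
  rcases b with k | _
  · exact (hasFDerivAt_stGrad_phase_inl hU hψ hω hz k).differentiableAt
  · exact (hasFDerivAt_stGrad_phase_inr hU hψ hω hz).differentiableAt

theorem bilinSymbol_add_matrix {κ : Type*} [Fintype κ] (A B : Matrix κ κ ℝ) (v w : κ → ℝ) :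
    bilinSymbol (A + B) v w = bilinSymbol A v w + bilinSymbol B v w := by
  simp [bilinSymbol_eq_dotProduct, Matrix.add_mulVec]

theorem bilinSymbol_smul_matrix {κ : Type*} [Fintype κ] (c : ℝ) (A : Matrix κ κ ℝ)
    (v w : κ → ℝ) : bilinSymbol (c • A) v w = c * bilinSymbol A v w := by
  simp [bilinSymbol_eq_dotProduct, Matrix.smul_mulVec]

theorem bilinSymbol_vecMulVec {κ : Type*} [Fintype κ] (p v : κ → ℝ) :
    bilinSymbol (Matrix.vecMulVec p p) v v = (p ⬝ᵥ v) ^ 2 := by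
  simp only [bilinSymbol, Matrix.vecMulVec_apply, dotProduct, sq, Finset.sum_mul_sum]
  exact Finset.sum_congr rfl fun a _ => Finset.sum_congr rfl fun b _ => by ring

/-- The list of the partial derivatives. -/
def grad (f : Space n → ℝ) (x : Space n) : Fin n → ℝ := fun j => partialD j f x

/-- The mixed derivatives ∂_x∂_t of the phase are those of ω and ∂_t² is -1. Together with -(dω·X)²
from the spatial Hessian, these terms complete the square -(dω·X + τ)². -/
theorem doubleBracket_phase (hU : IsOpen U) (hψ : ContDiffOn ℝ 2 ψ U) (hω : ContDiffOn ℝ 2 ω U) (hz : z.1 ∈ U)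
    (g : SmoothMetric n) (ζ : Fin n ⊕ Unit → ℝ) {X : Fin n → ℝ}
    (hX : X = (g.coeff z.1)⁻¹.mulVec fun k => ζ (Sum.inl k)) :
    doubleBracket (boxSymbol g z) (coeffDeriv (boxSymbol g) z) (stGrad (phase ι ψ ω) z)
        (stHess (phase ι ψ ω) z) ζ
      = 4 * (ι * Real.exp (ι * ψ z.1) * bilinSymbol (gHessian g ψ z.1) X X
        + (z.2 - ω z.1) * bilinSymbol (gHessian g ω z.1) X X
        + ι ^ 2 * Real.exp (ι * ψ z.1) * (grad ψ z.1 ⬝ᵥ X) ^ 2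
        - (grad ω z.1 ⬝ᵥ X + ζ (Sum.inr ())) ^ 2) := by
  have hψd := differentiableAt_of_contDiffOn two_ne_zero hU hψ hz
  have hωd := differentiableAt_of_contDiffOn two_ne_zero hU hω hz
  rw [doubleBracket_boxSymbol g z _ _ ζ hX]
  have hxx : ∀ j k, stHess (phase ι ψ ω) z (Sum.inl j) (Sum.inl k)
      = ι * Real.exp (ι * ψ z.1) * partialD j (partialD k ψ) z.1
        + ι ^ 2 * Real.exp (ι * ψ z.1) * (partialD j ψ z.1 * partialD k ψ z.1)
        + (z.2 - ω z.1) * partialD j (partialD k ω) z.1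
        - partialD j ω z.1 * partialD k ω z.1 := fun j k => by
    unfold stHess
    rw [(hasFDerivAt_stGrad_phase_inl hU hψ hω hz k).fderiv]
    simp [coordVec, partialD]
    ring
  have hxt : ∀ j, stHess (phase ι ψ ω) z (Sum.inl j) (Sum.inr ()) = partialD j ω z.1 :=
      fun j => by
    unfold stHess
    rw [(hasFDerivAt_stGrad_phase_inr hU hψ hω hz).fderiv]
    simp [coordVec, partialD]
  have htx : ∀ j, stHess (phase ι ψ ω) z (Sum.inr ()) (Sum.inl j) = partialD j ω z.1 :=
      fun j => by
    unfold stHess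
    rw [(hasFDerivAt_stGrad_phase_inl hU hψ hω hz j).fderiv]
    simp [coordVec]
  have htt : stHess (phase ι ψ ω) z (Sum.inr ()) (Sum.inr ()) = -1 := by
    unfold stHess
    rw [(hasFDerivAt_stGrad_phase_inr hU hψ hω hz).fderiv]
    simp [coordVec]
  have hcov : covariantHess g z.1
      (Matrix.of fun j k => stHess (phase ι ψ ω) z (Sum.inl j) (Sum.inl k))
      (fun i => stGrad (phase ι ψ ω) z (Sum.inl i))
      = (ι * Real.exp (ι * ψ z.1)) • gHessian g ψ z.1
        + (ι ^ 2 * Real.exp (ι * ψ z.1)) • Matrix.vecMulVec (grad ψ z.1) (grad ψ z.1)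
        + (z.2 - ω z.1) • gHessian g ω z.1
        + (-1 : ℝ) • Matrix.vecMulVec (grad ω z.1) (grad ω z.1) := by
    ext j k
    have hs : ∑ i, christoffel g i j k z.1 * (ι * Real.exp (ι * ψ z.1) * partialD i ψ z.1
          + (z.2 - ω z.1) * partialD i ω z.1)
        = ι * Real.exp (ι * ψ z.1) * ∑ i, christoffel g i j k z.1 * partialD i ψ z.1
          + (z.2 - ω z.1) * ∑ i, christoffel g i j k z.1 * partialD i ω z.1 := by
      rw [Finset.mul_sum, Finset.mul_sum, ← Finset.sum_add_distrib]
      exact Finset.sum_congr rfl fun i _ => by ring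
    simp only [covariantHess, gHessian, Matrix.of_apply, Matrix.add_apply, Matrix.smul_apply,
      Matrix.vecMulVec_apply, smul_eq_mul, hxx, stGrad_phase_inl hψd hωd, hs, grad]
    ring
  have hsum : ∑ j, (partialD j ω z.1 + partialD j ω z.1) * X j = 2 * (grad ω z.1 ⬝ᵥ X) := by
    simp only [dotProduct, grad, Finset.mul_sum]
    exact Finset.sum_congr rfl fun j _ => by ring
  simp only [hcov, bilinSymbol_add_matrix, bilinSymbol_smul_matrix, bilinSymbol_vecMulVec, hxt,
    htx, htt, hsum]
  ring

end Phase

/-! ### Bounds near a compact set -/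

section Compactness

variable {n : ℕ} {K U : Set (Space n)}

/-- Relaxing the bound attained on K by 1 makes it hold on an open set. Neighbourhoods are needed
because pseudoconvexity is required beyond the closed cylinder. -/
theorem exists_isOpen_forall_le (hK : IsCompact K) (hU : IsOpen U) (hKU : K ⊆ U)
    {f : Space n → ℝ} (hf : ContinuousOn f U) :
    ∃ V, IsOpen V ∧ K ⊆ V ∧ V ⊆ U ∧ ∃ C, ∀ x ∈ V, f x ≤ C := by
  obtain ⟨C, hC⟩ := (hK.image_of_continuousOn (hf.mono hKU)).bddAbove
  refine ⟨U ∩ f ⁻¹' Iio (C + 1), hf.isOpen_inter_preimage hU isOpen_Iio, fun x hx => ⟨hKU hx, ?_⟩,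
    inter_subset_left, C + 1, fun x hx => le_of_lt hx.2⟩
  exact lt_of_le_of_lt (hC (mem_image_of_mem f hx)) (lt_add_one C)

theorem exists_isOpen_forall_ge (hK : IsCompact K) (hU : IsOpen U) (hKU : K ⊆ U)
    {f : Space n → ℝ} (hf : ContinuousOn f U) (hpos : ∀ x ∈ K, 0 < f x) :
    ∃ V, IsOpen V ∧ K ⊆ V ∧ V ⊆ U ∧ ∃ a, 0 < a ∧ ∀ x ∈ V, a ≤ f x := by
  obtain ⟨a, ha, hle⟩ := hK.exists_forall_le' (hf.mono hKU) hpos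
  refine ⟨U ∩ f ⁻¹' Ioi (a / 2), hf.isOpen_inter_preimage hU isOpen_Ioi,
    fun x hx => ⟨hKU hx, ?_⟩, inter_subset_left, a / 2, half_pos ha, fun x hx => le_of_lt hx.2⟩
  exact lt_of_lt_of_le (half_lt_self ha) (hle x hx)

theorem abs_bilinSymbol_self_le (A : Matrix (Fin n) (Fin n) ℝ) (X : Fin n → ℝ) :
    |bilinSymbol A X X| ≤ (∑ i, ∑ j, |A i j|) * (X ⬝ᵥ X) := by
  have hX : ∀ i, X i ^ 2 ≤ X ⬝ᵥ X := fun i => by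
    simp only [dotProduct, ← sq]
    exact Finset.single_le_sum (f := fun i => X i ^ 2) (fun j _ => sq_nonneg _) (Finset.mem_univ i)
  unfold bilinSymbol
  rw [Finset.sum_mul]
  refine (Finset.abs_sum_le_sum_abs _ _).trans (Finset.sum_le_sum fun i _ => ?_)
  rw [Finset.sum_mul]
  refine (Finset.abs_sum_le_sum_abs _ _).trans (Finset.sum_le_sum fun j _ => ?_)
  rw [mul_assoc, abs_mul]
  refine mul_le_mul_of_nonneg_left (abs_le.mpr ⟨?_, ?_⟩) (abs_nonneg _) <;>
    nlinarith [hX i, hX j, sq_nonneg (X i + X j), sq_nonneg (X i - X j)]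

theorem exists_isOpen_bilin_le (hK : IsCompact K) (hU : IsOpen U) (hKU : K ⊆ U)
    {A : Space n → Matrix (Fin n) (Fin n) ℝ} (hA : ∀ i j, ContinuousOn (fun x => A x i j) U) :
    ∃ V, IsOpen V ∧ K ⊆ V ∧ V ⊆ U ∧ ∃ C, ∀ x ∈ V, ∀ X : Fin n → ℝ,
      |bilinSymbol (A x) X X| ≤ C * (X ⬝ᵥ X) := by
  obtain ⟨V, hV, hKV, hVU, C, hC⟩ := exists_isOpen_forall_le hK hU hKU
    (f := fun x => ∑ i, ∑ j, |A x i j|)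
    (continuousOn_finsetSum _ fun i _ => continuousOn_finsetSum _ fun j _ => (hA i j).abs)
  refine ⟨V, hV, hKV, hVU, C, fun x hx X => (abs_bilinSymbol_self_le _ _).trans ?_⟩
  exact mul_le_mul_of_nonneg_right (hC x hx) (Finset.sum_nonneg fun i _ => mul_self_nonneg _)

theorem dotProduct_self_eq_norm_sq (X : Space n) : X.ofLp ⬝ᵥ X.ofLp = ‖X‖ ^ 2 := by
  rw [EuclideanSpace.real_norm_sq_eq]
  simp [dotProduct, sq]

/-- The form is bounded below by some c > 0 on K times the unit sphere, which is compact; the tube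
lemma keeps the bound c/2 over a neighbourhood of K, uniformly in direction, and homogeneity extends
it to all X. -/
theorem exists_isOpen_bilin_ge (hK : IsCompact K) (hU : IsOpen U) (hKU : K ⊆ U)
    {A : Space n → Matrix (Fin n) (Fin n) ℝ} (hA : ∀ i j, ContinuousOn (fun x => A x i j) U)
    (hpos : ∀ x ∈ K, (A x).PosDef) :
    ∃ V, IsOpen V ∧ K ⊆ V ∧ V ⊆ U ∧ ∃ c, 0 < c ∧ ∀ x ∈ V, ∀ X : Fin n → ℝ,
      c * (X ⬝ᵥ X) ≤ bilinSymbol (A x) X X := by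
  set F : Space n × Space n → ℝ := fun p => bilinSymbol (A p.1) p.2.ofLp p.2.ofLp with hF
  have hFc : ContinuousOn F (U ×ˢ univ) := by
    refine continuousOn_finsetSum _ fun i _ => continuousOn_finsetSum _ fun j _ => ?_
    have h1 : ContinuousOn (fun p : Space n × Space n => A p.1 i j) (U ×ˢ univ) :=
      (hA i j).comp continuousOn_fst fun p hp => hp.1
    have h2 : ∀ k, ContinuousOn (fun p : Space n × Space n => p.2.ofLp k) (U ×ˢ univ) :=
      fun k => Continuous.continuousOn (by fun_prop)
    exact (h1.mul (h2 i)).mul (h2 j)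
  have hS : IsCompact (Metric.sphere (0 : Space n) 1) := isCompact_sphere _ _
  have hsub : K ×ˢ Metric.sphere (0 : Space n) 1 ⊆ U ×ˢ univ := prod_mono hKU (subset_univ _)
  have hFpos : ∀ p ∈ K ×ˢ Metric.sphere (0 : Space n) 1, 0 < F p := by
    rintro ⟨x, X⟩ ⟨hx, hX⟩
    have hX0 : X.ofLp ≠ 0 := fun h => by
      have : X = 0 := by ext i; simp [h]
      simp [this] at hX
    have := (hpos x hx).dotProduct_mulVec_pos hX0
    simpa [hF, bilinSymbol_eq_dotProduct] using this
  obtain ⟨c, hc, hle⟩ := (hK.prod hS).exists_forall_le' (hFc.mono hsub) hFpos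
  have hopen : IsOpen ((U ×ˢ univ) ∩ F ⁻¹' Ioi (c / 2)) :=
    hFc.isOpen_inter_preimage (hU.prod isOpen_univ) isOpen_Ioi
  obtain ⟨V, W, hV, -, hKV, hSW, hVW⟩ := generalized_tube_lemma hK hS hopen
    (fun p hp => ⟨hsub hp, lt_of_lt_of_le (half_lt_self hc) (hle p hp)⟩)
  refine ⟨V ∩ U, hV.inter hU, subset_inter hKV hKU, inter_subset_right, c / 2, half_pos hc,
    fun x hx X => ?_⟩
  by_cases hX : X = 0
  · simp [hX, bilinSymbol]
  set Y : Space n := WithLp.toLp 2 X with hY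
  have hY0 : ‖Y‖ ≠ 0 := by
    rw [norm_ne_zero_iff]
    intro h
    exact hX (by simpa [hY] using congrArg WithLp.ofLp h)
  have hmem : ‖Y‖⁻¹ • Y ∈ Metric.sphere (0 : Space n) 1 := by
    simp [norm_smul, hY0]
  have hlt : c / 2 < F (x, ‖Y‖⁻¹ • Y) := (hVW (mk_mem_prod hx.1 (hSW hmem))).2
  have hFs : F (x, ‖Y‖⁻¹ • Y) = (‖Y‖ ^ 2)⁻¹ * bilinSymbol (A x) X X := by
    simp only [hF, bilinSymbol_eq_dotProduct, WithLp.ofLp_smul, Matrix.mulVec_smul,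
      dotProduct_smul, smul_dotProduct, smul_eq_mul, hY]
    ring
  have hn : X ⬝ᵥ X = ‖Y‖ ^ 2 := dotProduct_self_eq_norm_sq Y
  have hp : 0 < ‖Y‖ ^ 2 := by positivity
  rw [hFs, inv_mul_eq_div, lt_div_iff₀ hp] at hlt
  rw [hn]
  exact hlt.le

end Compactness

/-! ### Constants for the metric, ψ and ω, uniform near the ball -/

section Bounds

variable {n : ℕ}

/-- Bounds, uniform on `V`, for the metric and for the derivatives of `ψ` and `ω`. -/
structure UniformBounds (g : SmoothMetric n) (ψ ω : Space n → ℝ) (V : Set (Space n))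
    (a c C : ℝ) : Prop where
  grad_ge : ∀ x ∈ V, a ≤ bilinSymbol (g.coeff x)⁻¹ (grad ψ x) (grad ψ x)
  grad_le : ∀ x ∈ V, bilinSymbol (g.coeff x)⁻¹ (grad ω x) (grad ω x) ≤ C
  hess_ge : ∀ x ∈ V, ∀ X : Fin n → ℝ, c * (X ⬝ᵥ X) ≤ bilinSymbol (gHessian g ψ x) X X
  hess_le : ∀ x ∈ V, ∀ X : Fin n → ℝ, |bilinSymbol (gHessian g ω x) X X| ≤ C * (X ⬝ᵥ X)
  deriv_le : ∀ x ∈ V, ∀ X : Fin n → ℝ, (grad ω x ⬝ᵥ X) ^ 2 ≤ C * (X ⬝ᵥ X)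
  metric_le : ∀ x ∈ V, ∀ X : Fin n → ℝ, bilinSymbol (g.coeff x) X X ≤ C * (X ⬝ᵥ X)

theorem continuous_partialD_of_smooth {f : Space n → ℝ}
    (hf : ContDiff ℝ ((⊤ : ℕ∞) : WithTop ℕ∞) f) (j : Fin n) : Continuous (partialD j f) :=
  (hf.continuous_fderiv (by simp)).clm_apply continuous_const

theorem continuous_christoffel (g : SmoothMetric n) (i j k : Fin n) :
    Continuous (christoffel g i j k) := by
  refine continuous_const.mul (continuous_finsetSum _ fun l _ => ?_)
  exact (g.contDiff_inv i l).continuous.mul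
    (((continuous_partialD_of_smooth (g.smooth l k) j).add
      (continuous_partialD_of_smooth (g.smooth l j) k)).sub
      (continuous_partialD_of_smooth (g.smooth j k) l))

theorem continuousOn_gHessian (g : SmoothMetric n) {f : Space n → ℝ} {U : Set (Space n)}
    (hU : IsOpen U) (hf : ContDiffOn ℝ 2 f U) (j k : Fin n) :
    ContinuousOn (fun x => gHessian g f x j k) U := by
  have h1 : ContinuousOn (partialD j (partialD k f)) U :=
    (((contDiffOn_partialD hU hf k).fderiv_of_isOpen (m := 0) hU (by norm_num)).clm_apply
      contDiffOn_const).continuousOn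
  simp only [gHessian, Matrix.of_apply]
  exact h1.sub (continuousOn_finsetSum _ fun i _ =>
    (continuous_christoffel g i j k).continuousOn.mul (contDiffOn_partialD hU hf i).continuousOn)

theorem grad_ne_zero {f : Space n → ℝ} {x : Space n} (h : fderiv ℝ f x ≠ 0) : grad f x ≠ 0 := by
  intro h0
  apply h
  refine ContinuousLinearMap.coe_injective
    ((EuclideanSpace.basisFun (Fin n) ℝ).toBasis.ext fun j => ?_)
  simpa [grad, partialD] using congrFun h0 j

theorem continuousOn_bilin_grad (g : SmoothMetric n) {f : Space n → ℝ} {U : Set (Space n)}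
    (hU : IsOpen U) (hf : ContDiffOn ℝ 2 f U) :
    ContinuousOn (fun x => bilinSymbol (g.coeff x)⁻¹ (grad f x) (grad f x)) U :=
  continuousOn_finsetSum _ fun i _ => continuousOn_finsetSum _ fun j _ =>
    ((g.contDiff_inv i j).continuous.continuousOn.mul
      (contDiffOn_partialD hU hf i).continuousOn).mul (contDiffOn_partialD hU hf j).continuousOn

theorem bilinSymbol_pos_of_posDef {A : Matrix (Fin n) (Fin n) ℝ} (hA : A.PosDef)
    {X : Fin n → ℝ} (hX : X ≠ 0) : 0 < bilinSymbol A X X := by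
  simpa [bilinSymbol_eq_dotProduct] using hA.dotProduct_mulVec_pos hX

theorem exists_uniformBounds (g : SmoothMetric n) {ψ ω : Space n → ℝ} {K U : Set (Space n)}
    (hK : IsCompact K) (hU : IsOpen U) (hKU : K ⊆ U) (hψ : ContDiffOn ℝ 2 ψ U)
    (hω : ContDiffOn ℝ 2 ω U) (hcrit : ∀ x ∈ K, fderiv ℝ ψ x ≠ 0)
    (hconv : ∀ x ∈ K, (gHessian g ψ x).PosDef) :
    ∃ V, IsOpen V ∧ K ⊆ V ∧ V ⊆ U ∧ ∃ a c C, 0 < a ∧ 0 < c ∧ 0 < C ∧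
      UniformBounds g ψ ω V a c C := by
  obtain ⟨V₁, hV₁, hK₁, hU₁, a, ha, h₁⟩ := exists_isOpen_forall_ge hK hU hKU
    (continuousOn_bilin_grad g hU hψ)
    (fun x hx => bilinSymbol_pos_of_posDef (g.inv_posDef x) (grad_ne_zero (hcrit x hx)))
  obtain ⟨V₂, hV₂, hK₂, hU₂, C₂, h₂⟩ := exists_isOpen_forall_le hK hU hKU
    (continuousOn_bilin_grad g hU hω)
  obtain ⟨V₃, hV₃, hK₃, hU₃, c, hc, h₃⟩ := exists_isOpen_bilin_ge hK hU hKU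
    (continuousOn_gHessian g hU hψ) hconv
  obtain ⟨V₄, hV₄, hK₄, hU₄, C₄, h₄⟩ := exists_isOpen_bilin_le hK hU hKU
    (continuousOn_gHessian g hU hω)
  obtain ⟨V₅, hV₅, hK₅, hU₅, C₅, h₅⟩ := exists_isOpen_bilin_le hK hU hKU
    (A := fun x => Matrix.vecMulVec (grad ω x) (grad ω x)) (fun i j =>
      (contDiffOn_partialD hU hω i).continuousOn.mul (contDiffOn_partialD hU hω j).continuousOn)
  obtain ⟨V₆, hV₆, hK₆, hU₆, C₆, h₆⟩ := exists_isOpen_bilin_le hK hU hKU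
    (A := g.coeff) (fun i j => (g.smooth i j).continuous.continuousOn)
  -- One constant dominating all the upper bounds; the summand 1 makes it positive.
  set C := |C₂| + |C₄| + |C₅| + |C₆| + 1 with hC
  have p₂ := abs_nonneg C₂
  have p₄ := abs_nonneg C₄
  have p₅ := abs_nonneg C₅
  have p₆ := abs_nonneg C₆
  have q₂ := le_abs_self C₂
  have q₄ := le_abs_self C₄
  have q₅ := le_abs_self C₅
  have q₆ := le_abs_self C₆
  have hXX : ∀ X : Fin n → ℝ, 0 ≤ X ⬝ᵥ X := fun X =>
    Finset.sum_nonneg fun i _ => mul_self_nonneg _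
  refine ⟨V₁ ∩ V₂ ∩ V₃ ∩ V₄ ∩ V₅ ∩ V₆, by
      exact ((((hV₁.inter hV₂).inter hV₃).inter hV₄).inter hV₅).inter hV₆,
    fun x hx => ⟨⟨⟨⟨⟨hK₁ hx, hK₂ hx⟩, hK₃ hx⟩, hK₄ hx⟩, hK₅ hx⟩, hK₆ hx⟩,
    fun x hx => hU₆ hx.2, a, c, C, ha, hc, by linarith, ?_⟩
  refine ⟨fun x hx => h₁ x hx.1.1.1.1.1, fun x hx => (h₂ x hx.1.1.1.1.2).trans (by linarith),
    fun x hx => h₃ x hx.1.1.1.2,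
    fun x hx X => (h₄ x hx.1.1.2 X).trans (mul_le_mul_of_nonneg_right (by linarith) (hXX X)),
    fun x hx X => ?_,
    fun x hx X => (le_abs_self _).trans
      ((h₆ x hx.2 X).trans (mul_le_mul_of_nonneg_right (by linarith) (hXX X)))⟩
  rw [← bilinSymbol_vecMulVec]
  exact (le_abs_self _).trans
    ((h₅ x hx.1.2 X).trans (mul_le_mul_of_nonneg_right (by linarith) (hXX X)))

end Bounds

/-! ### Strong pseudoconvexity of the weight -/

section Pseudoconvexity

variable {n : ℕ}

/-- This is half of A(p + 2q, p + 2q) ≥ 0, rearranged. -/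
theorem bilinSymbol_add_self_ge {A : Matrix (Fin n) (Fin n) ℝ} (hA : A.PosDef)
    (p q : Fin n → ℝ) :
    bilinSymbol A p p / 2 - bilinSymbol A q q ≤ bilinSymbol A (p + q) (p + q) := by
  have hs : A.IsSymm := by simpa [Matrix.IsHermitian, Matrix.IsSymm] using hA.isHermitian
  have h := hA.posSemidef.dotProduct_mulVec_nonneg (p + (2 : ℝ) • q)
  have hc := bilinSymbol_comm hs p q
  simp only [bilinSymbol_eq_dotProduct, Matrix.mulVec_add, Matrix.mulVec_smul, dotProduct_add,
    add_dotProduct, smul_dotProduct, dotProduct_smul, smul_eq_mul, star_trivial] at h hc ⊢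
  linarith

namespace UniformBounds

variable {g : SmoothMetric n} {ψ ω : Space n → ℝ} {V : Set (Space n)} {a c C M ι e u : ℝ}
  {x : Space n}

/-- The gradient of the phase is spacelike. -/
theorem sq_lt_bilin_grad_phase (hb : UniformBounds g ψ ω V a c C) (hx : x ∈ V)
    (hC : 0 < C) (he : 0 < e) (hu : |u| ≤ M * e) (hι : 1 ≤ ι)
    (hιa : 2 * (C + 1) * M ^ 2 < ι * a) :
    u ^ 2 < bilinSymbol (g.coeff x)⁻¹ ((ι * e) • grad ψ x + u • grad ω x)
      ((ι * e) • grad ψ x + u • grad ω x) := by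
  refine lt_of_lt_of_le ?_ (bilinSymbol_add_self_ge (g.inv_posDef x) _ _)
  have hs : ∀ (r : ℝ) (v : Fin n → ℝ), bilinSymbol (g.coeff x)⁻¹ (r • v) (r • v)
      = r ^ 2 * bilinSymbol (g.coeff x)⁻¹ v v := fun r v => by
    simp [bilinSymbol_eq_dotProduct, Matrix.mulVec_smul]; ring
  rw [hs, hs]
  have h1 : (ι * e) ^ 2 * a ≤ (ι * e) ^ 2 * bilinSymbol (g.coeff x)⁻¹ (grad ψ x) (grad ψ x) :=
    mul_le_mul_of_nonneg_left (hb.grad_ge x hx) (sq_nonneg _)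
  have h2 : u ^ 2 * bilinSymbol (g.coeff x)⁻¹ (grad ω x) (grad ω x) ≤ u ^ 2 * C :=
    mul_le_mul_of_nonneg_left (hb.grad_le x hx) (sq_nonneg _)
  have h3 : u ^ 2 ≤ (M * e) ^ 2 := by
    rw [← sq_abs]; exact pow_le_pow_left₀ (abs_nonneg u) hu 2
  have h4 : (C + 1) * u ^ 2 ≤ (C + 1) * (M * e) ^ 2 :=
    mul_le_mul_of_nonneg_left h3 (by linarith)
  -- As ι ≥ 1, the hypothesis on ιa implies the same bound for ι²a, which is what |ιe∇ψ|²/2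
  -- requires.
  have h5 : 2 * (C + 1) * M ^ 2 < ι ^ 2 * a := by
    have hM : 0 ≤ 2 * (C + 1) * M ^ 2 := by positivity
    have hp : 0 < ι * a := lt_of_le_of_lt hM hιa
    nlinarith
  have h6 : 2 * (C + 1) * M ^ 2 * e ^ 2 < ι ^ 2 * a * e ^ 2 :=
    mul_lt_mul_of_pos_right h5 (by positivity)
  nlinarith

/-- The Lorentzian Hessian of the phase is positive at the velocities of covectors that are not
timelike. -/
theorem hess_phase_pos (hb : UniformBounds g ψ ω V a c C) (hx : x ∈ V) (hC : 0 < C)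
    (he : 1 / 2 < e) (hu : |u| ≤ M * e) (hι : 1 ≤ ι) (hιc : 8 * C + M * C < ι * c)
    {ξ X : Fin n → ℝ} (hX : X = (g.coeff x)⁻¹.mulVec ξ) {τ : ℝ}
    (hτ : τ ^ 2 ≤ bilinSymbol (g.coeff x)⁻¹ ξ ξ) (hne : ξ ≠ 0 ∨ τ ≠ 0) :
    0 < ι * e * bilinSymbol (gHessian g ψ x) X X + u * bilinSymbol (gHessian g ω x) X X
      + ι ^ 2 * e * (grad ψ x ⬝ᵥ X) ^ 2 - (grad ω x ⬝ᵥ X + τ) ^ 2 := by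
  have hξ : ξ = (g.coeff x).mulVec X := by
    rw [hX, Matrix.mulVec_mulVec,
      Matrix.mul_nonsing_inv _ (isUnit_iff_ne_zero.mpr (g.det_ne_zero x)), Matrix.one_mulVec]
  have hq : bilinSymbol (g.coeff x)⁻¹ ξ ξ = bilinSymbol (g.coeff x) X X := by
    rw [bilinSymbol_eq_dotProduct, ← hX, hξ, bilinSymbol_eq_dotProduct, dotProduct_comm]
  -- If X = 0 then ξ = 0, and a covector that is not timelike then has τ = 0 as well.
  have hX0 : X ≠ 0 := by
    intro h0
    have hξ0 : ξ = 0 := by rw [hξ, h0, Matrix.mulVec_zero]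
    rw [hq, h0, show bilinSymbol (g.coeff x) 0 0 = 0 by simp [bilinSymbol]] at hτ
    exact hne.elim (fun h => h hξ0) fun h => h (pow_eq_zero_iff two_ne_zero |>.mp
      (le_antisymm hτ (sq_nonneg τ)))
  have hXX : 0 < X ⬝ᵥ X := by
    rw [lt_iff_le_and_ne]
    refine ⟨Finset.sum_nonneg fun i _ => mul_self_nonneg _, fun h => hX0 ?_⟩
    exact dotProduct_self_eq_zero.mp h.symm
  set s := X ⬝ᵥ X
  have hτ' : τ ^ 2 ≤ C * s := hτ.trans (hq ▸ hb.metric_le x hx X)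
  have he0 : 0 < e := by linarith
  have h1 : ι * e * (c * s) ≤ ι * e * bilinSymbol (gHessian g ψ x) X X :=
    mul_le_mul_of_nonneg_left (hb.hess_ge x hx X) (by positivity)
  have h2 : |u * bilinSymbol (gHessian g ω x) X X| ≤ M * e * (C * s) := by
    rw [abs_mul]
    exact mul_le_mul hu (hb.hess_le x hx X) (abs_nonneg _) ((abs_nonneg u).trans hu)
  have h2' := (abs_le.mp h2).1
  have h3 := hb.deriv_le x hx X
  have h4 : 0 ≤ ι ^ 2 * e * (grad ψ x ⬝ᵥ X) ^ 2 := by positivity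
  -- (A + τ)² ≤ 2A² + 2τ², each square being at most C|X|². Since e > 1/2, 4C|X|² is less than
  -- 8Ce|X|²; hence the 8C in the threshold for ι.
  have h5 : (grad ω x ⬝ᵥ X + τ) ^ 2 ≤ 4 * (C * s) := by
    nlinarith [sq_nonneg (grad ω x ⬝ᵥ X - τ)]
  have h6 : (8 * C + M * C) * (e * s) < ι * c * (e * s) :=
    mul_lt_mul_of_pos_right hιc (by positivity)
  have h7 : 0 < C * s := by positivity
  nlinarith

end UniformBounds

theorem contDiffOn_weight {ψ ω : Space n → ℝ} {U : Set (Space n)} {ι lam : ℝ}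
    (hψ : ContDiffOn ℝ 2 ψ U) (hω : ContDiffOn ℝ 2 ω U) :
    ContDiffOn ℝ 2 (weight ι lam ψ ω) (Prod.fst ⁻¹' U) := by
  have h1 : ContDiffOn ℝ 2 (fun w : SpaceTime n => ψ w.1) (Prod.fst ⁻¹' U) :=
    hψ.comp contDiffOn_fst fun w hw => hw
  have h2 : ContDiffOn ℝ 2 (fun w : SpaceTime n => ω w.1) (Prod.fst ⁻¹' U) :=
    hω.comp contDiffOn_fst fun w hw => hw
  exact (contDiffOn_const.mul ((contDiffOn_const.mul h1).exp.sub
    (((contDiffOn_snd.sub h2).pow 2).div_const 2))).exp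

theorem weight_pos (ι lam : ℝ) (ψ ω : Space n → ℝ) (z : SpaceTime n) :
    0 < weight ι lam ψ ω z := Real.exp_pos _

/-- A set where the uniform bounds make the weight strongly pseudoconvex. -/
def weightDomain (ι M : ℝ) (ψ ω : Space n → ℝ) (V : Set (Space n)) : Set (SpaceTime n) :=
  {z | z.1 ∈ V ∧ |z.2 - ω z.1| < M * Real.exp (ι * ψ z.1) ∧ 1 / 2 < Real.exp (ι * ψ z.1)}

theorem isOpen_weightDomain {ι M : ℝ} {ψ ω : Space n → ℝ} {V : Set (Space n)} (hV : IsOpen V)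
    (hψ : ContinuousOn ψ V) (hω : ContinuousOn ω V) : IsOpen (weightDomain ι M ψ ω V) := by
  have hP : IsOpen (Prod.fst ⁻¹' V : Set (SpaceTime n)) := hV.preimage continuous_fst
  have h1 : ContinuousOn (fun w : SpaceTime n => Real.exp (ι * ψ w.1)) (Prod.fst ⁻¹' V) :=
    (continuousOn_const.mul (hψ.comp continuousOn_fst fun w hw => hw)).rexp
  have h2 : ContinuousOn (fun w : SpaceTime n => |w.2 - ω w.1|) (Prod.fst ⁻¹' V) :=
    (continuousOn_snd.sub (hω.comp continuousOn_fst fun w hw => hw)).abs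
  have h3 := ((continuousOn_const (c := M)).mul h1).sub h2
  have e1 := h3.isOpen_inter_preimage hP (isOpen_Ioi (a := (0 : ℝ)))
  have e2 := h1.isOpen_inter_preimage hP (isOpen_Ioi (a := (1 / 2 : ℝ)))
  convert e1.inter e2 using 1
  ext z
  simp only [weightDomain, mem_ofPred_eq, mem_inter_iff, mem_preimage, mem_Ioi, sub_pos,
    Pi.sub_apply, Pi.mul_apply]
  tauto

theorem stronglyPseudoconvexOn_weight {g : SmoothMetric n} {ψ ω : Space n → ℝ}
    {U V : Set (Space n)} {a c C M ι lam : ℝ} (hU : IsOpen U) (hVU : V ⊆ U)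
    (hψ : ContDiffOn ℝ 2 ψ U) (hω : ContDiffOn ℝ 2 ω U) (hb : UniformBounds g ψ ω V a c C)
    (hC : 0 < C) (hι : 1 ≤ ι) (hιa : 2 * (C + 1) * M ^ 2 < ι * a)
    (hιc : 8 * C + M * C < ι * c) (hlam : 0 < lam) :
    StronglyPseudoconvexOn (boxSymbol g) (weight ι lam ψ ω) (weightDomain ι M ψ ω V) := by
  have hphase : ∀ z ∈ weightDomain ι M ψ ω V, DifferentiableAt ℝ (phase ι ψ ω) z := fun z hz =>
    (eventually_differentiableAt_phase hU hψ hω (hVU hz.1)).self_of_nhds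
  have hgrad : ∀ z ∈ weightDomain ι M ψ ω V, stGrad (weight ι lam ψ ω) z
      = (lam * weight ι lam ψ ω z) • stGrad (phase ι ψ ω) z := fun z hz => by
    funext b; exact stGrad_exp (hphase z hz) lam b
  have hGd : ∀ z ∈ weightDomain ι M ψ ω V, ∀ b,
      DifferentiableAt ℝ (fun w => stGrad (weight ι lam ψ ω) w b) z := fun z hz b =>
    differentiableAt_stGrad_exp (eventually_differentiableAt_phase hU hψ hω (hVU hz.1))
      (differentiableAt_stGrad_phase hU hψ hω (hVU hz.1)) lam b
  have hscale : ∀ z, 0 < lam * weight ι lam ψ ω z := fun z => mul_pos hlam (weight_pos _ _ _ _ _)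
  have hν : ∀ z ∈ weightDomain ι M ψ ω V, (fun k => stGrad (phase ι ψ ω) z (Sum.inl k))
      = (ι * Real.exp (ι * ψ z.1)) • grad ψ z.1 + (z.2 - ω z.1) • grad ω z.1 := fun z hz => by
    funext k
    exact stGrad_phase_inl (differentiableAt_of_contDiffOn two_ne_zero hU hψ (hVU hz.1))
      (differentiableAt_of_contDiffOn two_ne_zero hU hω (hVU hz.1)) k
  have hμ : ∀ z ∈ weightDomain ι M ψ ω V, stGrad (phase ι ψ ω) z (Sum.inr ())
      = -(z.2 - ω z.1) := fun z hz =>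
    stGrad_phase_inr (differentiableAt_of_contDiffOn two_ne_zero hU hψ (hVU hz.1))
      (differentiableAt_of_contDiffOn two_ne_zero hU hω (hVU hz.1))
  have hspace : ∀ z ∈ weightDomain ι M ψ ω V,
      stGrad (phase ι ψ ω) z (Sum.inr ()) ^ 2 < bilinSymbol (g.coeff z.1)⁻¹
        (fun k => stGrad (phase ι ψ ω) z (Sum.inl k))
        (fun k => stGrad (phase ι ψ ω) z (Sum.inl k)) := fun z hz => by
    rw [hν z hz, hμ z hz, neg_sq]
    exact hb.sq_lt_bilin_grad_phase hz.1 hC (Real.exp_pos _) hz.2.1.le hι hιa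
  -- Positivity at all nonzero null or spacelike covectors; both bracket conditions are instances of
  -- it.
  have hmain : ∀ z ∈ weightDomain ι M ψ ω V, ∀ ζ : Fin n ⊕ Unit → ℝ, ζ ≠ 0 →
      ζ (Sum.inr ()) ^ 2 ≤ bilinSymbol (g.coeff z.1)⁻¹ (fun k => ζ (Sum.inl k))
        (fun k => ζ (Sum.inl k)) →
      0 < doubleBracket (boxSymbol g z) (coeffDeriv (boxSymbol g) z)
        (stGrad (weight ι lam ψ ω) z) (stHess (weight ι lam ψ ω) z) ζ := by
    intro z hz ζ hζ hτ
    have hH : stHess (weight ι lam ψ ω) z = fun a b => lam * weight ι lam ψ ω z *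
        (stHess (phase ι ψ ω) z a b
          + lam * (stGrad (phase ι ψ ω) z a * stGrad (phase ι ψ ω) z b)) := by
      funext a b
      exact stHess_exp (eventually_differentiableAt_phase hU hψ hω (hVU hz.1))
        (differentiableAt_stGrad_phase hU hψ hω (hVU hz.1)) lam a b
    rw [hgrad z hz, hH, doubleBracket_exp (boxSymbol_isSymm g z),
      doubleBracket_phase hU hψ hω (hVU hz.1) g ζ rfl]
    have hne : (fun k => ζ (Sum.inl k)) ≠ 0 ∨ ζ (Sum.inr ()) ≠ 0 := by
      by_contra! h
      refine hζ (funext fun b => ?_)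
      rcases b with k | _
      · exact congrFun h.1 k
      · exact h.2
    have hpos := hb.hess_phase_pos hz.1 hC hz.2.2 hz.2.1.le hι hιc rfl hτ hne
    exact mul_pos (hscale z) (add_pos_of_pos_of_nonneg (by linarith) (by positivity))
  have hNne : ∀ z ∈ weightDomain ι M ψ ω V, stGrad (phase ι ψ ω) z ≠ 0 := fun z hz h0 => by
    have := hspace z hz
    simp [h0, bilinSymbol] at this
  refine ⟨(contDiffOn_weight hψ hω).mono fun z hz => hVU hz.1, fun z hz h0 => ?_,
    fun z hz ζ hζ hp _ => ?_, fun z hz ζ σ hσ hp => ?_⟩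
  · have h1 : stGrad (weight ι lam ψ ω) z = 0 := by
      funext b; simp [stGrad, h0]
    rw [hgrad z hz] at h1
    exact (smul_eq_zero.mp h1).elim (hscale z).ne' (hNne z hz)
  · rw [poisson_realSymbol_function (boxSymbol_isSymm g),
      poisson_bracketSymbol (boxSymbol_isSymm g) (differentiableAt_boxSymbol g z) (hGd z hz)]
    refine hmain z hz _ (fun h0 => hζ ?_) ?_
    · refine Prod.ext (PiLp.ext fun k => congrFun h0 (Sum.inl k)) (congrFun h0 (Sum.inr ()))
    · rw [realSymbol, quadSymbol_real, bilinSymbol_boxSymbol] at hp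
      linarith
  · rw [poisson_conjugatedSymbol (boxSymbol_isSymm g) (differentiableAt_boxSymbol g z) (hGd z hz)
      ζ hσ]
    rw [conjugatedSymbol_eq (boxSymbol_isSymm g)] at hp
    have hre : realSymbol (boxSymbol g) z ζ - σ ^ 2 * bilinSymbol (boxSymbol g z)
        (stGrad (weight ι lam ψ ω) z) (stGrad (weight ι lam ψ ω) z) = 0 := by
      simpa [Complex.add_re, Complex.mul_re, ← Complex.ofReal_pow] using congrArg Complex.re hp
    have hlt : stGrad (weight ι lam ψ ω) z (Sum.inr ()) ^ 2 < bilinSymbol (g.coeff z.1)⁻¹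
        (fun k => stGrad (weight ι lam ψ ω) z (Sum.inl k))
        (fun k => stGrad (weight ι lam ψ ω) z (Sum.inl k)) := by
      have h := mul_lt_mul_of_pos_left (hspace z hz) (pow_pos (hscale z) 2)
      rw [hgrad z hz]
      have hs : (fun k => ((lam * weight ι lam ψ ω z) • stGrad (phase ι ψ ω) z) (Sum.inl k))
          = (lam * weight ι lam ψ ω z) • fun k => stGrad (phase ι ψ ω) z (Sum.inl k) := rfl
      rw [hs]
      simp only [bilinSymbol_eq_dotProduct, Matrix.mulVec_smul, dotProduct_smul, smul_dotProduct,
        smul_eq_mul, Pi.smul_apply] at h ⊢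
      linarith
    have hNw : stGrad (weight ι lam ψ ω) z ≠ 0 := by
      rw [hgrad z hz]; exact smul_ne_zero (hscale z).ne' (hNne z hz)
    have h2 := hmain z hz _ hNw hlt.le
    have hσ2 : 0 < σ ^ 2 := by positivity
    rw [realSymbol, quadSymbol_real, bilinSymbol_boxSymbol, bilinSymbol_boxSymbol] at hre
    -- The real part of the vanishing symbol reads p(ζ) = σ² p(N), and p(N) > 0 because N is
    -- spacelike.
    have hτ : coords ζ (Sum.inr ()) ^ 2 < bilinSymbol (g.coeff z.1)⁻¹
        (fun k => coords ζ (Sum.inl k)) (fun k => coords ζ (Sum.inl k)) := by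
      nlinarith [mul_pos hσ2 (sub_pos.mpr hlt)]
    have hζ0 : coords ζ ≠ 0 := fun h0 => by
      simp [h0, bilinSymbol] at hτ
    have h1 := hmain z hz _ hζ0 hτ.le
    have := mul_pos hσ2 h2
    linarith

end Pseudoconvexity

/-! ### The shift of ψ, the height T and the levels of the weight -/

section Levels

variable {n : ℕ}

theorem isCompact_closedUnitBall : IsCompact (closedUnitBall n) := isCompact_closedBall _ _

theorem zero_mem_closedUnitBall : (0 : Space n) ∈ closedUnitBall n := by
  simp [closedUnitBall]

/-- The shift uses extrema over the open ball; by continuity and density they also bound the values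
on the boundary. -/
theorem le_sSup_image_unitBall {f : Space n → ℝ} (hf : ContinuousOn f (closedUnitBall n))
    {x : Space n} (hx : x ∈ closedUnitBall n) :
    sInf (f '' unitBall n) ≤ f x ∧ f x ≤ sSup (f '' unitBall n) := by
  have hsub : unitBall n ⊆ closedUnitBall n := Metric.ball_subset_closedBall
  have hcl : closedUnitBall n = closure (unitBall n) := (closure_ball 0 one_ne_zero).symm
  have hK := isCompact_closedUnitBall.image_of_continuousOn hf
  have hmem : f x ∈ closure (f '' unitBall n) :=
    ((hf x hx).mono hsub).mem_closure_image (hcl ▸ hx)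
  have habove := hK.bddAbove.mono (image_mono hsub)
  have hbelow := hK.bddBelow.mono (image_mono hsub)
  exact closure_minimal (t := Icc (sInf (f '' unitBall n)) (sSup (f '' unitBall n)))
    (fun y hy => ⟨csInf_le hbelow hy, le_csSup habove hy⟩) isClosed_Icc hmem

theorem shifted_nonneg {f : Space n → ℝ} (hf : ContinuousOn f (closedUnitBall n))
    {x : Space n} (hx : x ∈ closedUnitBall n) : 0 ≤ shifted f x := by
  have h := le_sSup_image_unitBall hf hx
  simp only [shifted]; linarith

theorem shifted_le_two_mul {f : Space n → ℝ} (hf : ContinuousOn f (closedUnitBall n))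
    {x y : Space n} (hx : x ∈ closedUnitBall n) (hy : y ∈ closedUnitBall n) :
    shifted f x ≤ 2 * shifted f y := by
  have h1 := le_sSup_image_unitBall hf hx
  have h2 := le_sSup_image_unitBall hf hy
  simp only [shifted]; linarith

variable {ι lam : ℝ} {ψ ω : Space n → ℝ}

theorem continuousOn_exp_mul (hψ : ContinuousOn ψ (closedUnitBall n)) (ι : ℝ) :
    ContinuousOn (fun x => Real.exp (ι * ψ x)) (closedUnitBall n) :=
  (continuousOn_const.mul hψ).rexp

theorem sInf_exp_le (hψ : ContinuousOn ψ (closedUnitBall n)) {x : Space n}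
    (hx : x ∈ closedUnitBall n) :
    sInf ((fun y => Real.exp (ι * ψ y)) '' closedUnitBall n) ≤ Real.exp (ι * ψ x) :=
  csInf_le (isCompact_closedUnitBall.image_of_continuousOn (continuousOn_exp_mul hψ ι)).bddBelow
    (mem_image_of_mem _ hx)

theorem sInf_exp_nonneg :
    0 ≤ sInf ((fun y => Real.exp (ι * ψ y)) '' closedUnitBall n) :=
  Real.sInf_nonneg (by rintro _ ⟨x, -, rfl⟩; exact (Real.exp_pos _).le)

theorem abs_le_sSup_abs (hω : ContinuousOn ω (closedUnitBall n)) {x : Space n}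
    (hx : x ∈ closedUnitBall n) : |ω x| ≤ sSup ((fun x => |ω x|) '' closedUnitBall n) :=
  le_csSup (isCompact_closedUnitBall.image_of_continuousOn hω.abs).bddAbove
    (mem_image_of_mem (fun x => |ω x|) hx)

theorem le_halfHeight (hψ : ContinuousOn ψ (closedUnitBall n)) {x : Space n}
    (hx : x ∈ closedUnitBall n) :
    Real.sqrt (2 * (Real.exp (ι * ψ x) - sInf ((fun y => Real.exp (ι * ψ y)) '' closedUnitBall n)))
      + sSup ((fun x => |ω x|) '' closedUnitBall n) + 1 ≤ halfHeight ι ψ ω := by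
  unfold halfHeight
  gcongr
  refine le_csSup (isCompact_closedUnitBall.image_of_continuousOn ?_).bddAbove
    (mem_image_of_mem (fun x => Real.sqrt (2 * (Real.exp (ι * ψ x)
      - sInf ((fun y => Real.exp (ι * ψ y)) '' closedUnitBall n)))) hx)
  exact (continuousOn_const.mul ((continuousOn_exp_mul hψ ι).sub continuousOn_const)).sqrt

/-- Bounds the global quantity T by e^{ιψ} at an arbitrary point y: doubling ψ(y) squares its
exponential, and the square root in T undoes the squaring. -/
theorem halfHeight_le {f : Space n → ℝ} (hf : ContinuousOn f (closedUnitBall n)) (hι : 0 ≤ ι)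
    {y : Space n} (hy : y ∈ closedUnitBall n) :
    halfHeight ι (shifted f) ω ≤ 2 * Real.exp (ι * shifted f y)
      + sSup ((fun x => |ω x|) '' closedUnitBall n) + 1 := by
  unfold halfHeight
  gcongr
  refine csSup_le (Nonempty.image _ ⟨0, zero_mem_closedUnitBall⟩) ?_
  rintro _ ⟨x, hx, rfl⟩
  refine Real.sqrt_le_iff.mpr ⟨by positivity, ?_⟩
  have h1 : Real.exp (ι * shifted f x) ≤ Real.exp (ι * shifted f y) ^ 2 := by
    rw [← Real.exp_nat_mul]
    apply Real.exp_le_exp.mpr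
    have := mul_le_mul_of_nonneg_left (shifted_le_two_mul hf hx hy) hι
    push_cast; linarith
  have h2 := sInf_exp_nonneg (n := n) (ι := ι) (ψ := shifted f)
  nlinarith [sq_nonneg (Real.exp (ι * shifted f y))]

theorem one_le_halfHeight (hψ : ContinuousOn ψ (closedUnitBall n)) : 1 ≤ halfHeight ι ψ ω := by
  have h := le_halfHeight (ι := ι) (ω := ω) hψ (zero_mem_closedUnitBall (n := n))
  have h1 := Real.sqrt_nonneg (2 * (Real.exp (ι * ψ 0)
    - sInf ((fun y => Real.exp (ι * ψ y)) '' closedUnitBall n)))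
  have h2 : 0 ≤ sSup ((fun x => |ω x|) '' closedUnitBall n) :=
    Real.sSup_nonneg (by rintro _ ⟨x, -, rfl⟩; exact abs_nonneg _)
  linarith

/-- On the top and bottom slices the phase is below its values on the graph of `ω`. -/
theorem phase_slice_lt (hψ : ContinuousOn ψ (closedUnitBall n))
    (hω : ContinuousOn ω (closedUnitBall n)) {x y : Space n} (hx : x ∈ closedUnitBall n)
    (hy : y ∈ closedUnitBall n) {t : ℝ} (ht : |t| = halfHeight ι ψ ω) :
    phase ι ψ ω (y, t) < phase ι ψ ω (x, ω x) := by
  have h1 := le_halfHeight (ι := ι) (ω := ω) hψ hy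
  have h2 := abs_le_sSup_abs hω hy
  have h3 := sInf_exp_le (ι := ι) hψ hx
  have h4 := sInf_exp_le (ι := ι) hψ hy
  set m := sInf ((fun y => Real.exp (ι * ψ y)) '' closedUnitBall n)
  set r := Real.sqrt (2 * (Real.exp (ι * ψ y) - m)) with hr
  have hr0 : 0 ≤ r := Real.sqrt_nonneg _
  have hr2 : r ^ 2 = 2 * (Real.exp (ι * ψ y) - m) := Real.sq_sqrt (by linarith)
  -- Subtracting |ω(y)| ≤ sup|ω| from |t| = T leaves r and the summand 1 of T. That 1 makes the
  -- final inequality strict: (r + 1)²/2 > r²/2 = e^{ιψ(y)} - m.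
  have h5 : r + 1 ≤ |t - ω y| := by
    have := abs_sub_abs_le_abs_sub t (ω y)
    linarith
  have h6 : (r + 1) ^ 2 ≤ (t - ω y) ^ 2 := by
    rw [← sq_abs (t - ω y)]
    exact pow_le_pow_left₀ (by linarith) h5 2
  simp only [phase, sub_self]
  nlinarith

theorem continuousOn_weight (hψ : ContinuousOn ψ (closedUnitBall n))
    (hω : ContinuousOn ω (closedUnitBall n)) :
    ContinuousOn (weight ι lam ψ ω) (closedUnitBall n ×ˢ univ) := by
  have h1 : ContinuousOn (fun w : SpaceTime n => ψ w.1) (closedUnitBall n ×ˢ univ) :=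
    hψ.comp continuousOn_fst fun w hw => hw.1
  have h2 : ContinuousOn (fun w : SpaceTime n => ω w.1) (closedUnitBall n ×ˢ univ) :=
    hω.comp continuousOn_fst fun w hw => hw.1
  exact (continuousOn_const.mul ((continuousOn_const.mul h1).rexp.sub
    (((continuousOn_snd.sub h2).pow 2).div_const 2))).rexp

/-- Both surfaces are compact, so the extrema are attained, and comparing them reduces to comparing
the phase at two points. -/
theorem weight_levels (hψ : ContinuousOn ψ (closedUnitBall n))
    (hω : ContinuousOn ω (closedUnitBall n)) (hlam : 0 < lam) {T : ℝ}
    (hT : T = halfHeight ι ψ ω) {φ : SpaceTime n → ℝ} (hφ : φ = weight ι lam ψ ω) :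
    IsLeast (φ '' graphSurface ω) (sInf (φ '' graphSurface ω)) ∧
      IsGreatest (φ '' (slice n T ∪ slice n (-T))) (sSup (φ '' (slice n T ∪ slice n (-T)))) ∧
      sSup (φ '' (slice n T ∪ slice n (-T))) < sInf (φ '' graphSurface ω) := by
  have hc := continuousOn_weight (ι := ι) (lam := lam) hψ hω
  rw [← hφ] at hc
  have hgraph : graphSurface ω = (fun x => (x, ω x)) '' closedUnitBall n := by
    ext ⟨x, t⟩
    simp only [graphSurface, mem_ofPred_eq, mem_image, Prod.mk.injEq]
    constructor
    · rintro ⟨hx, ht⟩; exact ⟨x, hx, rfl, ht.symm⟩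
    · rintro ⟨y, hy, rfl, rfl⟩; exact ⟨hy, rfl⟩
  have hslice : ∀ τ, slice n τ = closedUnitBall n ×ˢ {τ} := fun τ => by
    ext ⟨x, t⟩; simp [slice]
  have hgc : IsCompact (graphSurface ω) := by
    rw [hgraph]
    exact isCompact_closedUnitBall.image_of_continuousOn (continuousOn_id.prodMk hω)
  have hsc : IsCompact (slice n T ∪ slice n (-T)) := by
    rw [hslice, hslice]
    exact (isCompact_closedUnitBall.prod isCompact_singleton).union
      (isCompact_closedUnitBall.prod isCompact_singleton)
  have hL := (hgc.image_of_continuousOn (hc.mono fun z hz => ⟨hz.1, mem_univ _⟩)).isLeast_sInf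
    (Nonempty.image _ ⟨(0, ω 0), zero_mem_closedUnitBall, rfl⟩)
  have hG := (hsc.image_of_continuousOn (hc.mono fun z hz =>
      ⟨hz.elim (fun h => h.1) fun h => h.1, mem_univ _⟩)).isGreatest_sSup
    (Nonempty.image _ ⟨(0, T), Or.inl ⟨zero_mem_closedUnitBall, rfl⟩⟩)
  refine ⟨hL, hG, ?_⟩
  obtain ⟨⟨x, s⟩, ⟨hx, hs⟩, hxe⟩ := hL.1
  obtain ⟨⟨y, t⟩, hyt, hye⟩ := hG.1
  have hs' : s = ω x := hs
  have hT0 : 0 ≤ T := by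
    have := one_le_halfHeight (ι := ι) (ω := ω) hψ
    linarith
  have hy : y ∈ closedUnitBall n := hyt.elim (fun h => h.1) fun h => h.1
  have ht : |t| = halfHeight ι ψ ω := by
    rw [← hT]
    rcases hyt with h | h
    · rw [show t = T from h.2, abs_of_nonneg hT0]
    · rw [show t = -T from h.2, abs_neg, abs_of_nonneg hT0]
  rw [← hxe, ← hye, hs', hφ]
  exact Real.exp_lt_exp.mpr (mul_lt_mul_of_pos_left (phase_slice_lt hψ hω hx hy ht) hlam)

end Levels

/-! ### Time integrals of the weight -/

section Integrals

variable {n : ℕ} {ι lam : ℝ} {ψ ω : Space n → ℝ}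

theorem continuous_weight_time (x : Space n) : Continuous fun t : ℝ => weight ι lam ψ ω (x, t) := by
  simp only [weight, phase]
  fun_prop

theorem weight_sub_graph (x : Space n) (t : ℝ) :
    weight ι lam ψ ω (x, t) - weight ι lam ψ ω (x, ω x)
      = Real.exp (lam * Real.exp (ι * ψ x)) * (Real.exp (-lam * (t - ω x) ^ 2 / 2) - 1) := by
  have h : lam * (Real.exp (ι * ψ x) - (t - ω x) ^ 2 / 2)
      = lam * Real.exp (ι * ψ x) + -lam * (t - ω x) ^ 2 / 2 := by ring
  simp only [weight, phase, sub_self, h, Real.exp_add]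
  norm_num
  ring

theorem exp_neg_mul_sq_le_one (hlam : 0 < lam) (u : ℝ) : Real.exp (-lam * u ^ 2 / 2) ≤ 1 :=
  Real.exp_le_one_iff.mpr (by nlinarith [sq_nonneg u])

/-- By `weight_sub_graph` the exponent is bounded in absolute value uniformly on the closed ball,
which handles either sign of σ. -/
theorem bddAbove_weightIntegrals (hψ : ContinuousOn ψ (closedUnitBall n)) (hlam : 0 < lam)
    (T σ : ℝ) : BddAbove (weightIntegrals (weight ι lam ψ ω) ω T σ) := by
  obtain ⟨W, hW⟩ := (isCompact_closedUnitBall.image_of_continuousOn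
    ((continuousOn_exp_mul hψ ι).const_mul lam).rexp).bddAbove
  refine ⟨Real.exp (2 * |σ| * W) * |T - -T|, ?_⟩
  rintro _ ⟨x, hx, rfl⟩
  refine (Real.le_norm_self _).trans
    (intervalIntegral.norm_integral_le_of_norm_le_const fun t _ => ?_)
  rw [Real.norm_of_nonneg (Real.exp_pos _).le]
  apply Real.exp_le_exp.mpr
  have hx' : Real.exp (lam * Real.exp (ι * ψ x)) ≤ W := hW (mem_image_of_mem _ hx)
  have h1 : |weight ι lam ψ ω (x, t) - weight ι lam ψ ω (x, ω x)| ≤ W := by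
    rw [weight_sub_graph, abs_mul, Real.abs_exp]
    refine le_trans (mul_le_of_le_one_right (Real.exp_pos _).le ?_) hx'
    have := exp_neg_mul_sq_le_one hlam (t - ω x)
    have := Real.exp_pos (-lam * (t - ω x) ^ 2 / 2)
    rw [abs_le]; constructor <;> linarith
  calc 2 * σ * (weight ι lam ψ ω (x, t) - weight ι lam ψ ω (x, ω x))
      ≤ |2 * σ * (weight ι lam ψ ω (x, t) - weight ι lam ψ ω (x, ω x))| := le_abs_self _
    _ = 2 * |σ| * |weight ι lam ψ ω (x, t) - weight ι lam ψ ω (x, ω x)| := by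
        rw [abs_mul, abs_mul, abs_two]
    _ ≤ 2 * |σ| * W := mul_le_mul_of_nonneg_left h1 (by positivity)

/-- Gives a majorant independent of x: the factor e^{λe} ≥ 1 multiplies a nonpositive number and can
be dropped, and after translation by ω(x) the interval lies in [-R, R]. -/
theorem integral_weight_le (hω : ContinuousOn ω (closedUnitBall n)) (hlam : 0 < lam) {T σ : ℝ}
    (hT : 0 ≤ T) (hσ : 0 ≤ σ) {x : Space n} (hx : x ∈ closedUnitBall n) {R : ℝ}
    (hR : R = T + sSup ((fun x => |ω x|) '' closedUnitBall n)) :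
    ∫ t in (-T)..T, Real.exp (2 * σ * (weight ι lam ψ ω (x, t) - weight ι lam ψ ω (x, ω x)))
      ≤ ∫ u in (-R)..R, Real.exp (2 * σ * (Real.exp (-lam * u ^ 2 / 2) - 1)) := by
  have hcont : Continuous fun u : ℝ =>
      Real.exp (2 * σ * (Real.exp (-lam * u ^ 2 / 2) - 1)) := by fun_prop
  have hωx := abs_le.mp (abs_le_sSup_abs hω hx)
  calc ∫ t in (-T)..T, Real.exp (2 * σ * (weight ι lam ψ ω (x, t) - weight ι lam ψ ω (x, ω x)))
      ≤ ∫ t in (-T)..T, Real.exp (2 * σ * (Real.exp (-lam * (t - ω x) ^ 2 / 2) - 1)) := by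
        refine intervalIntegral.integral_mono_on (by linarith) ?_ ?_ fun t _ => ?_
        · exact (Real.continuous_exp.comp (continuous_const.mul
            ((continuous_weight_time x).sub continuous_const))).intervalIntegrable _ _
        · exact (hcont.comp (continuous_id.sub continuous_const)).intervalIntegrable _ _
        · apply Real.exp_le_exp.mpr
          refine mul_le_mul_of_nonneg_left ?_ (by positivity)
          rw [weight_sub_graph]
          have h1 : 1 ≤ Real.exp (lam * Real.exp (ι * ψ x)) := Real.one_le_exp (by positivity)
          have h2 := exp_neg_mul_sq_le_one hlam (t - ω x)
          nlinarith
    _ = ∫ u in (-T - ω x)..(T - ω x), Real.exp (2 * σ * (Real.exp (-lam * u ^ 2 / 2) - 1)) :=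
        intervalIntegral.integral_comp_sub_right
          (fun u => Real.exp (2 * σ * (Real.exp (-lam * u ^ 2 / 2) - 1))) (ω x)
    _ ≤ _ := intervalIntegral.integral_mono_interval (by linarith) (by linarith) (by linarith)
        (Eventually.of_forall fun u => (Real.exp_pos _).le) (hcont.intervalIntegrable _ _)

/-- Dominated convergence with majorant 1: the exponent tends to -∞ for every u except the null set
u = 0. -/
theorem tendsto_integral_exp_zero (hlam : 0 < lam) (R : ℝ) :
    Tendsto (fun σ : ℝ => ∫ u in (-R)..R, Real.exp (2 * σ * (Real.exp (-lam * u ^ 2 / 2) - 1)))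
      atTop (𝓝 0) := by
  have h0 : ∫ _ in (-R)..R, (0 : ℝ) = 0 := by simp
  rw [← h0]
  refine intervalIntegral.tendsto_integral_filter_of_dominated_convergence (fun _ => 1)
    (Eventually.of_forall fun σ => ?_) ?_ intervalIntegrable_const ?_
  · exact Continuous.aestronglyMeasurable (by fun_prop)
  · filter_upwards [eventually_ge_atTop 0] with σ hσ
    refine Eventually.of_forall fun u _ => ?_
    rw [Real.norm_of_nonneg (Real.exp_pos _).le]
    exact Real.exp_le_one_iff.mpr (mul_nonpos_of_nonneg_of_nonpos (by positivity)
      (sub_nonpos.mpr (exp_neg_mul_sq_le_one hlam u)))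
  · have hne : ∀ᵐ u : ℝ, u ≠ 0 := MeasureTheory.Measure.ae_ne MeasureTheory.volume 0
    filter_upwards [hne] with u hu _
    have hlt : Real.exp (-lam * u ^ 2 / 2) - 1 < 0 := by
      rw [sub_neg]
      have : 0 < lam * u ^ 2 := by positivity
      exact Real.exp_lt_one_iff.mpr (by linarith)
    refine Real.tendsto_exp_atBot.comp ?_
    exact (tendsto_id.const_mul_atTop two_pos).atTop_mul_const_of_neg hlt

theorem tendsto_sSup_weightIntegrals (hω : ContinuousOn ω (closedUnitBall n)) (hlam : 0 < lam)
    {T : ℝ} (hT : 0 ≤ T) :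
    Tendsto (fun σ : ℝ => sSup (weightIntegrals (weight ι lam ψ ω) ω T σ)) atTop (𝓝 0) := by
  refine squeeze_zero' (Eventually.of_forall fun σ => ?_) ?_ (tendsto_integral_exp_zero hlam
    (T + sSup ((fun x => |ω x|) '' closedUnitBall n)))
  · refine Real.sSup_nonneg ?_
    rintro _ ⟨x, -, rfl⟩
    exact intervalIntegral.integral_nonneg (by linarith) fun t _ => (Real.exp_pos _).le
  · filter_upwards [eventually_ge_atTop 0] with σ hσ
    refine csSup_le (Nonempty.image _ ⟨0, zero_mem_closedUnitBall⟩) ?_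
    rintro _ ⟨x, hx, rfl⟩
    exact integral_weight_le hω hlam hT hσ hx rfl

end Integrals

/-! ### Choice of the constants and conclusion -/

theorem partialD_shifted {n : ℕ} (f : Space n → ℝ) (j : Fin n) :
    partialD j (shifted f) = partialD j f := by
  funext x
  simp only [partialD]
  congr 1
  exact fderiv_add_const _

theorem gHessian_shifted {n : ℕ} (g : SmoothMetric n) (f : Space n → ℝ) :
    gHessian g (shifted f) = gHessian g f := by
  funext x
  simp only [gHessian, partialD_shifted]

theorem closure_cylinder_subset {n : ℕ} (T : ℝ) :
    closure (cylinder n T) ⊆ closedUnitBall n ×ˢ Icc (-T) T :=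
  closure_minimal (prod_mono Metric.ball_subset_closedBall subset_rfl)
    (Metric.isClosed_closedBall.prod isClosed_Icc)

theorem lemma4p2 (n : ℕ) (g : SmoothMetric n) (ψt ω : Space n → ℝ)
    (hω : ContDiffNearBall ((⊤ : ℕ∞) : WithTop ℕ∞) ω)
    (hψ : ContDiffNearBall 2 ψt)
    (hcrit : ∀ x ∈ closedUnitBall n, fderiv ℝ ψt x ≠ 0)
    (hconv : ∀ x ∈ closedUnitBall n, (gHessian g ψt x).PosDef) :
    ∃ ι₀ lam₀ : ℝ, ∀ ι lam : ℝ, ι₀ ≤ ι → lam₀ ≤ lam →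
      ∀ (T : ℝ) (φ : SpaceTime n → ℝ),
        T = halfHeight ι (shifted ψt) ω → φ = weight ι lam (shifted ψt) ω →
        (∃ N : Set (SpaceTime n), IsOpen N ∧ closure (cylinder n T) ⊆ N ∧
          StronglyPseudoconvexOn (boxSymbol g) φ N) ∧
        (IsLeast (φ '' graphSurface ω) (sInf (φ '' graphSurface ω)) ∧
          IsGreatest (φ '' (slice n T ∪ slice n (-T)))
            (sSup (φ '' (slice n T ∪ slice n (-T)))) ∧
          sSup (φ '' (slice n T ∪ slice n (-T))) < sInf (φ '' graphSurface ω)) ∧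
        ((∀ σ : ℝ, BddAbove (weightIntegrals φ ω T σ)) ∧
          Tendsto (fun σ : ℝ => sSup (weightIntegrals φ ω T σ)) atTop (𝓝 0)) := by
  obtain ⟨U₁, hU₁, hK₁, hω₁⟩ := hω
  obtain ⟨U₂, hU₂, hK₂, hψ₂⟩ := hψ
  have hU : IsOpen (U₁ ∩ U₂) := hU₁.inter hU₂
  have hKU : closedUnitBall n ⊆ U₁ ∩ U₂ := subset_inter hK₁ hK₂
  have hωU : ContDiffOn ℝ 2 ω (U₁ ∩ U₂) :=
    (hω₁.mono inter_subset_left).of_le (WithTop.coe_le_coe.mpr (le_top (a := (2 : ℕ∞))))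
  have hψU : ContDiffOn ℝ 2 (shifted ψt) (U₁ ∩ U₂) :=
    (hψ₂.mono inter_subset_right).add contDiffOn_const
  have hψtK : ContinuousOn ψt (closedUnitBall n) := hψ₂.continuousOn.mono hK₂
  have hψK : ContinuousOn (shifted ψt) (closedUnitBall n) := hψU.continuousOn.mono hKU
  have hωK : ContinuousOn ω (closedUnitBall n) := hωU.continuousOn.mono hKU
  obtain ⟨V, hV, hKV, hVU, a, c, C, ha, hc, hC, hb⟩ := exists_uniformBounds g
    isCompact_closedUnitBall hU hKU hψU hωU
    (fun x hx => by
      rw [show fderiv ℝ (shifted ψt) x = fderiv ℝ ψt x from fderiv_add_const _]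
      exact hcrit x hx)
    (fun x hx => by rw [gHessian_shifted]; exact hconv x hx)
  set Ω := sSup ((fun x => |ω x|) '' closedUnitBall n) with hΩ
  have hΩ0 : 0 ≤ Ω := Real.sSup_nonneg (by rintro _ ⟨x, -, rfl⟩; exact abs_nonneg _)
  -- M depends on ω alone, hence can be fixed before ι.
  set M := 2 * Ω + 4 with hM
  -- The two quotients are the thresholds for a spacelike gradient and for a positive Hessian; 1
  -- serves as λ₀ only to ensure λ > 0.
  refine ⟨max 1 (max (2 * (C + 1) * M ^ 2 / a + 1) ((8 * C + M * C) / c + 1)), 1,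
    fun ι lam hι hlam T φ hT hφ => ?_⟩
  have hlam0 : 0 < lam := by linarith
  have hι1 : 1 ≤ ι := (le_max_left _ _).trans hι
  have hιa : 2 * (C + 1) * M ^ 2 < ι * a := by
    rw [← div_lt_iff₀ ha]
    have := ((le_max_left _ _).trans (le_max_right _ _)).trans hι
    linarith
  have hιc : 8 * C + M * C < ι * c := by
    rw [← div_lt_iff₀ hc]
    have := ((le_max_right _ _).trans (le_max_right _ _)).trans hι
    linarith
  have hT0 : 0 ≤ T := by
    have := one_le_halfHeight (ι := ι) (ω := ω) hψK
    linarith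
  refine ⟨⟨weightDomain ι M (shifted ψt) ω V,
      isOpen_weightDomain hV (hψU.continuousOn.mono hVU) (hωU.continuousOn.mono hVU),
      (closure_cylinder_subset T).trans fun z hz => ?_, ?_⟩,
    weight_levels hψK hωK hlam0 hT hφ, ?_, ?_⟩
  · have h1 : 1 ≤ Real.exp (ι * shifted ψt z.1) :=
      Real.one_le_exp (mul_nonneg (by linarith) (shifted_nonneg hψtK hz.1))
    refine ⟨hKV hz.1, ?_, by linarith⟩
    -- With e = e^{ιψ} ≥ 1 at this point, |t - ω| ≤ T + Ω ≤ 2e + 2Ω + 1 < (2Ω + 4)e.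
    have h2 := halfHeight_le (ω := ω) hψtK (by linarith : (0 : ℝ) ≤ ι) hz.1
    have h3 : |z.2| ≤ T := abs_le.mpr hz.2
    have h4 := abs_le_sSup_abs hωK hz.1
    have h5 := abs_sub z.2 (ω z.1)
    nlinarith
  · rw [hφ]
    exact stronglyPseudoconvexOn_weight hU hVU hψU hωU hb hC hι1 hιa hιc hlam0
  · rw [hφ]
    exact bddAbove_weightIntegrals hψK hlam0 T
  · rw [hφ]
    exact tendsto_sSup_weightIntegrals hωK hlam0 hT0

end
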